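/- Let $\epsilon\in\{-1,0,1\}$ and $r>0$, with $r\le 1$ if $\epsilon=\pm1$, and let $\mathbb D(r)=\{x\in\mathbb R^2:|x|<r\}$. For $x\in\mathbb D(r)$, $\xi\in\mathbb R^2$ put $$\alpha(x,\xi)=\frac{\sqrt{(r^2-|x|^2)|\xi|^2+\langle x,\xi\rangle^2}}{r^2-|x|^2},\qquad \beta(x,\xi)=\frac{(1+\epsilon r^2)\langle x,\xi\rangle}{(r^2-|x|^2)(1+\epsilon|x|^2)},$$ and let $\mathcal F_\epsilon=\alpha+\beta$ be the Funk–Finsler metric on $\mathbb D(r)$. For a function $F$ on the tangent bundle, with summation over repeated indices, let $g_{ij}=\tfrac12\,\partial^2F^2/\partial\xi^i\partial\xi^j$, let $(g^{ij})$ be the inverse matrix, let $$G^i=\tfrac14 g^{i\ell}\left\{[F^2]_{x^k\xi^\ell}\xi^k-[F^2]_{x^\ell}\right\},\qquad R^i_k=2\frac{\partial G^i}{\partial x^k}-\xi^j\frac{\partial^2G^i}{\partial x^j\partial\xi^k}+2G^j\frac{\partial^2G^i}{\partial\xi^j\partial\xi^k}-\frac{\partial G^i}{\partial\xi^j}\frac{\partial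 G^j}{\partial\xi^k},$$ $\mathbf{Ric}=R^i_i$, and, with $g_\xi(u,v)=g_{ij}(x,\xi)u^iv^j$ and $R_\xi(u)^i=R^i_k u^k$, $$\mathbf K(x,\xi,P)=\frac{g_\xi(R_\xi(u),u)}{g_\xi(\xi,\xi)g_\xi(u,u)-g_\xi(\xi,u)^2},\qquad P=\operatorname{span}\{\xi,u\}\ \text{a plane}.$$ Then $\mathcal F_\epsilon$ is a Finsler structure on $\mathbb D(r)$ (nonnegative, smooth where $\xi\ne0$, positively $1$-homogeneous in $\xi$, with $(g_{ij})$ positive definite where $\xi\neq0$), and for all $x\in\mathbb D(r)$ and $\xi\ne0$ its Riemann curvature is $$R^i_k=-\left(\delta^i_k\alpha^2-\alpha\alpha_k\xi^i\right)+\left[3\left(\frac{\phi}{2\mathcal F_\epsilon}\right)^2-\frac{\psi}{2\mathcal F_\epsilon}\right]\left(\delta^i_k-\frac{(\mathcal F_\epsilon)_{\xi^k}}{\mathcal F_\epsilon}\xi^i\right)+\tau_k\xi^i,\qquad \alpha_k=\frac{\partial\alpha}{\partial\xi^k},$$ where $$\phi=\frac{(1+\epsilon r^2)\left[(1+\epsilon|x|^2)|\xi|^2-2\epsilon\langle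 x,\xi\rangle^2\right]}{(r^2-|x|^2)(1+\epsilon|x|^2)^2},$$ $$\psi=\frac{-2(1+\epsilon r^2)\langle x,\xi\rangle}{(1+\epsilon|x|^2)^3(r^2-|x|^2)^2}\left[(1+\epsilon|x|^2)|\xi|^2(3\epsilon r^2-2\epsilon|x|^2+1)-2\epsilon\langle x,\xi\rangle^2(1-\epsilon|x|^2+2\epsilon r^2)\right],$$ $$\tau_k=\frac{(1+\epsilon r^2)\left(x^k|\xi|^2-\xi^k\langle x,\xi\rangle\right)}{\mathcal F_\epsilon\,(r^2-|x|^2)^2(1+\epsilon|x|^2)}.$$ Moreover, for every $u\in\mathbb R^2$ linearly independent of $\xi$, with $P=\operatorname{span}\{\xi,u\}$, $$\mathbf{Ric}=\mathbf K(x,\xi,P)\,\mathcal F_\epsilon^2=3\left(\frac{\phi}{2\mathcal F_\epsilon}\right)^2-\frac{\psi}{2\mathcal F_\epsilon}-\alpha^2 .$$ -/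

import Mathlib

/-! Finsler structures on open subsets of `ℝⁿ`, with `T U = U × ℝⁿ`; a function on the tangent
bundle is a curried function `F x ξ` of the base point `x` and the tangent vector `ξ`. -/

namespace FunkFinsler

open scoped ContDiff

noncomputable section

/-- The partial derivative `∂f/∂xⁱ`, as a function on the tangent bundle. -/
def pdBase {n : ℕ} (i : Fin n)
    (f : EuclideanSpace ℝ (Fin n) → EuclideanSpace ℝ (Fin n) → ℝ) :
    EuclideanSpace ℝ (Fin n) → EuclideanSpace ℝ (Fin n) → ℝ :=
  fun x ξ => lineDeriv ℝ (fun y => f y ξ) x (EuclideanSpace.single i 1)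

/-- The partial derivative `∂f/∂ξⁱ`, as a function on the tangent bundle. -/
def pdFibre {n : ℕ} (i : Fin n)
    (f : EuclideanSpace ℝ (Fin n) → EuclideanSpace ℝ (Fin n) → ℝ) :
    EuclideanSpace ℝ (Fin n) → EuclideanSpace ℝ (Fin n) → ℝ :=
  fun x ξ => lineDeriv ℝ (fun η => f x η) ξ (EuclideanSpace.single i 1)

/-- The function `F²` on the tangent bundle. -/
def sq {n : ℕ} (F : EuclideanSpace ℝ (Fin n) → EuclideanSpace ℝ (Fin n) → ℝ) :
    EuclideanSpace ℝ (Fin n) → EuclideanSpace ℝ (Fin n) → ℝ :=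
  fun x ξ => F x ξ ^ 2

/-- The fundamental tensor `g_{ij} = ½ ∂²F²/∂ξⁱ∂ξʲ`. -/
def fundamentalTensor {n : ℕ}
    (F : EuclideanSpace ℝ (Fin n) → EuclideanSpace ℝ (Fin n) → ℝ)
    (x ξ : EuclideanSpace ℝ (Fin n)) : Matrix (Fin n) (Fin n) ℝ :=
  Matrix.of fun i j => (1 / 2) * pdFibre i (pdFibre j (sq F)) x ξ

/-- `F` is a Finsler structure on the (open) set `U ⊆ ℝⁿ`. -/
structure IsFinslerOn {n : ℕ} (U : Set (EuclideanSpace ℝ (Fin n)))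
    (F : EuclideanSpace ℝ (Fin n) → EuclideanSpace ℝ (Fin n) → ℝ) : Prop where
  nonneg : ∀ x ∈ U, ∀ ξ, 0 ≤ F x ξ
  smooth : ContDiffOn ℝ ∞
    (fun p : EuclideanSpace ℝ (Fin n) × EuclideanSpace ℝ (Fin n) => F p.1 p.2)
    {p | p.1 ∈ U ∧ p.2 ≠ 0}
  homogeneous : ∀ x ∈ U, ∀ ξ, ∀ c : ℝ, 0 < c → F x (c • ξ) = c * F x ξ
  posDef : ∀ x ∈ U, ∀ ξ, ξ ≠ 0 → (fundamentalTensor F x ξ).PosDef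

/-- The spray coefficients
`Gⁱ = ¼ g^{iℓ} ([F²]_{x^k ξ^ℓ} ξ^k - [F²]_{x^ℓ})`. -/
def spray {n : ℕ} (F : EuclideanSpace ℝ (Fin n) → EuclideanSpace ℝ (Fin n) → ℝ)
    (i : Fin n) (x ξ : EuclideanSpace ℝ (Fin n)) : ℝ :=
  (1 / 4) * ∑ l, (fundamentalTensor F x ξ)⁻¹ i l *
    ((∑ k, pdFibre l (pdBase k (sq F)) x ξ * ξ k) - pdBase l (sq F) x ξ)

/-- The coefficients `Rⁱ_k` of the Riemann curvature tensor:
`2 ∂Gⁱ/∂x^k - ξʲ ∂²Gⁱ/∂xʲ∂ξ^k + 2 Gʲ ∂²Gⁱ/∂ξʲ∂ξ^k - (∂Gⁱ/∂ξʲ) (∂Gʲ/∂ξ^k)`. -/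
def riemannCurvature {n : ℕ}
    (F : EuclideanSpace ℝ (Fin n) → EuclideanSpace ℝ (Fin n) → ℝ)
    (i k : Fin n) (x ξ : EuclideanSpace ℝ (Fin n)) : ℝ :=
  2 * pdBase k (spray F i) x ξ
    - ∑ j, ξ j * pdBase j (pdFibre k (spray F i)) x ξ
    + 2 * ∑ j, spray F j x ξ * pdFibre j (pdFibre k (spray F i)) x ξ
    - ∑ j, pdFibre j (spray F i) x ξ * pdFibre k (spray F j) x ξ

/-- The Ricci curvature `Ric = Rⁱ_i`. -/
def ricciCurvature {n : ℕ}
    (F : EuclideanSpace ℝ (Fin n) → EuclideanSpace ℝ (Fin n) → ℝ)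
    (x ξ : EuclideanSpace ℝ (Fin n)) : ℝ :=
  ∑ i, riemannCurvature F i i x ξ

/-- The inner product `g_ξ(u, v) = g_{ij}(x, ξ) uⁱ vʲ`. -/
def gInner {n : ℕ} (F : EuclideanSpace ℝ (Fin n) → EuclideanSpace ℝ (Fin n) → ℝ)
    (x ξ u v : EuclideanSpace ℝ (Fin n)) : ℝ :=
  ∑ i, ∑ j, fundamentalTensor F x ξ i j * u i * v j

/-- The Riemann curvature `R_ξ(u) = Rⁱ_k u^k ∂/∂xⁱ` as a map of the tangent space. -/
def riemannMap {n : ℕ} (F : EuclideanSpace ℝ (Fin n) → EuclideanSpace ℝ (Fin n) → ℝ)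
    (x ξ u : EuclideanSpace ℝ (Fin n)) : EuclideanSpace ℝ (Fin n) :=
  WithLp.toLp 2 fun i => ∑ k, riemannCurvature F i k x ξ * u k

/-- The flag curvature `K(x, ξ, P)` of the plane `P = span {ξ, u}` with pole `ξ`
(meaningful for linearly independent `ξ`, `u`). -/
def flagCurvature {n : ℕ}
    (F : EuclideanSpace ℝ (Fin n) → EuclideanSpace ℝ (Fin n) → ℝ)
    (x ξ u : EuclideanSpace ℝ (Fin n)) : ℝ :=
  gInner F x ξ (riemannMap F x ξ u) u /
    (gInner F x ξ ξ ξ * gInner F x ξ u u - gInner F x ξ ξ u ^ 2)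

/-- The Riemannian metric `α` on the disc of radius `r`. -/
def alpha (r : ℝ) (x ξ : EuclideanSpace ℝ (Fin 2)) : ℝ :=
  Real.sqrt ((r ^ 2 - ‖x‖ ^ 2) * ‖ξ‖ ^ 2 + inner ℝ x ξ ^ 2) / (r ^ 2 - ‖x‖ ^ 2)

/-- The `1`-form `β` on the disc of radius `r`. -/
def beta (ε r : ℝ) (x ξ : EuclideanSpace ℝ (Fin 2)) : ℝ :=
  (1 + ε * r ^ 2) * inner ℝ x ξ / ((r ^ 2 - ‖x‖ ^ 2) * (1 + ε * ‖x‖ ^ 2))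

/-- The Funk–Finsler metric `F_ε = α + β` on the disc of radius `r`. -/
def funk (ε r : ℝ) (x ξ : EuclideanSpace ℝ (Fin 2)) : ℝ :=
  alpha r x ξ + beta ε r x ξ

/-- The explicit function `φ`. -/
def phi (ε r : ℝ) (x ξ : EuclideanSpace ℝ (Fin 2)) : ℝ :=
  (1 + ε * r ^ 2) * ((1 + ε * ‖x‖ ^ 2) * ‖ξ‖ ^ 2 - 2 * ε * inner ℝ x ξ ^ 2) /
    ((r ^ 2 - ‖x‖ ^ 2) * (1 + ε * ‖x‖ ^ 2) ^ 2)

/-- The explicit function `ψ`. -/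
def psi (ε r : ℝ) (x ξ : EuclideanSpace ℝ (Fin 2)) : ℝ :=
  -2 * (1 + ε * r ^ 2) * inner ℝ x ξ /
      ((1 + ε * ‖x‖ ^ 2) ^ 3 * (r ^ 2 - ‖x‖ ^ 2) ^ 2) *
    ((1 + ε * ‖x‖ ^ 2) * ‖ξ‖ ^ 2 * (3 * ε * r ^ 2 - 2 * ε * ‖x‖ ^ 2 + 1)
      - 2 * ε * inner ℝ x ξ ^ 2 * (1 - ε * ‖x‖ ^ 2 + 2 * ε * r ^ 2))

/-- The explicit covector `τ_k`. -/
def tau (ε r : ℝ) (k : Fin 2) (x ξ : EuclideanSpace ℝ (Fin 2)) : ℝ :=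
  (1 + ε * r ^ 2) * (x k * ‖ξ‖ ^ 2 - ξ k * inner ℝ x ξ) /
    (funk ε r x ξ * (r ^ 2 - ‖x‖ ^ 2) ^ 2 * (1 + ε * ‖x‖ ^ 2))

end

end FunkFinsler

/-!
The Funk–Finsler metric `F = α + β` is projectively flat: `α` is, up to scaling, the Klein model of
the hyperbolic metric, whose geodesics are straight segments, and the `1`-form `β` is closed. Its
curvature is therefore computed for an arbitrary projectively flat metric first.

A Finsler metric `F` on an open subset of `ℝⁿ` has straight geodesics exactly when Hamel's equations
`ξʲ F_{xʲ ξᵏ} = F_{xᵏ}` hold. With `P` defined by `ξʲ F_{xʲ} = 2 F P`, Euler's identity for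
`F` reduces the spray to `Gⁱ = P ξⁱ` (`IsProjectiveFactor.spray_eq`), and differentiating the
defining equation of `P` along the fibre gives `F_{xᵏ} = (P F)_{ξᵏ}`. Inserting `Gⁱ = P ξⁱ` into the
definition, `Rⁱ_k = Ξ δⁱ_k + T_k ξⁱ`, where `Ξ = P² - ξʲ P_{xʲ}` and
`T_k = 2 P_{xᵏ} - ξʲ P_{xʲ ξᵏ} - P P_{ξᵏ}`. Differentiating `ξʲ F_{xʲ} = 2 F P` in `xᵏ` and
comparing with the derivative of `F_{xᵏ} = (P F)_{ξᵏ}` along `ξ` yields `F T_k = -Ξ F_{ξᵏ}`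
(`IsProjectiveFactor.compat`). Hence `Rⁱ_k = Ξ (δⁱ_k - F⁻¹ F_{ξᵏ} ξⁱ)`, from which the Ricci
curvature `(n - 1) Ξ` and the flag curvature `Ξ / F²` are read off.

For the Funk–Finsler metric put `A² = (r² - |x|²)|ξ|² + ⟨x, ξ⟩²`. This is constant along the lines
`x + tξ`, which makes the derivatives along them short: they give Hamel's equations, the projective
factor `P = ⟨x, ξ⟩ / (r² - |x|²) + φ / (2F)` (`isProjectiveFactor_funk`), and
`Ξ = 3 (φ / 2F)² - ψ / 2F - α²` (`flatCurvature_funkFactor`). The stated form of `Rⁱ_k` follows from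
`F τ_k = α (α F_{ξᵏ} - F α_{ξᵏ})` (`tau_eq`). Strong convexity of `F` reduces to `F > 0`, that is
`|β| < α`. The bound `r ≤ 1` is needed there when `ε = 1`, and for `1 + ε|x|² > 0` when `ε = -1`.
-/

namespace FunkFinsler

open scoped ContDiff

/-! ### Calculus on the tangent bundle with the zero section removed -/

section Calculus

variable {n : ℕ} {U : Set (EuclideanSpace ℝ (Fin n))}
  {f g : EuclideanSpace ℝ (Fin n) → EuclideanSpace ℝ (Fin n) → ℝ}
  {x ξ : EuclideanSpace ℝ (Fin n)}

/-- `f` is smooth on the tangent bundle of `U` with the zero section removed. -/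
def SmoothOffZero (U : Set (EuclideanSpace ℝ (Fin n)))
    (f : EuclideanSpace ℝ (Fin n) → EuclideanSpace ℝ (Fin n) → ℝ) : Prop :=
  ContDiffOn ℝ ∞ (fun p : EuclideanSpace ℝ (Fin n) × EuclideanSpace ℝ (Fin n) => f p.1 p.2)
    {p | p.1 ∈ U ∧ p.2 ≠ 0}

theorem isOpen_slit (hU : IsOpen U) :
    IsOpen {p : EuclideanSpace ℝ (Fin n) × EuclideanSpace ℝ (Fin n) | p.1 ∈ U ∧ p.2 ≠ 0} :=
  (hU.preimage continuous_fst).inter (isOpen_ne.preimage continuous_snd)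

theorem SmoothOffZero.contDiffAt (hf : SmoothOffZero U f) (hU : IsOpen U) (hx : x ∈ U)
    (hξ : ξ ≠ 0) : ContDiffAt ℝ ∞
      (fun p : EuclideanSpace ℝ (Fin n) × EuclideanSpace ℝ (Fin n) => f p.1 p.2) (x, ξ) :=
  ContDiffOn.contDiffAt hf ((isOpen_slit hU).mem_nhds ⟨hx, hξ⟩)

theorem SmoothOffZero.differentiableAt (hf : SmoothOffZero U f) (hU : IsOpen U) (hx : x ∈ U)
    (hξ : ξ ≠ 0) : DifferentiableAt ℝ
      (fun p : EuclideanSpace ℝ (Fin n) × EuclideanSpace ℝ (Fin n) => f p.1 p.2) (x, ξ) :=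
  (hf.contDiffAt hU hx hξ).differentiableAt (by simp)

theorem SmoothOffZero.differentiableAt_base (hf : SmoothOffZero U f) (hU : IsOpen U)
    (hx : x ∈ U) (hξ : ξ ≠ 0) : DifferentiableAt ℝ (fun y => f y ξ) x :=
  (hf.differentiableAt hU hx hξ).comp (f := fun y => (y, ξ)) x
    (differentiableAt_id.prodMk (differentiableAt_const ξ))

theorem SmoothOffZero.differentiableAt_fibre (hf : SmoothOffZero U f) (hU : IsOpen U)
    (hx : x ∈ U) (hξ : ξ ≠ 0) : DifferentiableAt ℝ (fun η => f x η) ξ :=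
  (hf.differentiableAt hU hx hξ).comp (f := fun η => (x, η)) ξ
    ((differentiableAt_const x).prodMk differentiableAt_id)

theorem lineDeriv_base_eq (hf : SmoothOffZero U f) (hU : IsOpen U) (hx : x ∈ U) (hξ : ξ ≠ 0)
    (v : EuclideanSpace ℝ (Fin n)) :
    lineDeriv ℝ (fun y => f y ξ) x v = fderiv ℝ
      (fun p : EuclideanSpace ℝ (Fin n) × EuclideanSpace ℝ (Fin n) => f p.1 p.2) (x, ξ) (v, 0) := by
  have h1 := (hf.differentiableAt hU hx hξ).hasFDerivAt.comp (f := fun y => (y, ξ)) x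
    ((hasFDerivAt_id x).prodMk (hasFDerivAt_const ξ x))
  exact (h1.hasLineDerivAt v).lineDeriv

theorem lineDeriv_fibre_eq (hf : SmoothOffZero U f) (hU : IsOpen U) (hx : x ∈ U) (hξ : ξ ≠ 0)
    (v : EuclideanSpace ℝ (Fin n)) :
    lineDeriv ℝ (fun η => f x η) ξ v = fderiv ℝ
      (fun p : EuclideanSpace ℝ (Fin n) × EuclideanSpace ℝ (Fin n) => f p.1 p.2) (x, ξ) (0, v) := by
  have h1 := (hf.differentiableAt hU hx hξ).hasFDerivAt.comp (f := fun η => (x, η)) ξ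
    ((hasFDerivAt_const x ξ).prodMk (hasFDerivAt_id ξ))
  exact (h1.hasLineDerivAt v).lineDeriv

theorem SmoothOffZero.congr (hf : SmoothOffZero U f) (h : ∀ x ∈ U, ∀ ξ, ξ ≠ 0 → g x ξ = f x ξ) :
    SmoothOffZero U g :=
  ContDiffOn.congr hf fun p hp => h p.1 hp.1 p.2 hp.2

theorem SmoothOffZero.fderiv_apply (hf : SmoothOffZero U f) (hU : IsOpen U)
    (w : EuclideanSpace ℝ (Fin n) × EuclideanSpace ℝ (Fin n)) :
    SmoothOffZero U fun x ξ => fderiv ℝ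
      (fun p : EuclideanSpace ℝ (Fin n) × EuclideanSpace ℝ (Fin n) => f p.1 p.2) (x, ξ) w :=
  (ContDiffOn.fderiv_of_isOpen hf (isOpen_slit hU) (m := ∞) (by simp)).clm_apply contDiffOn_const

theorem SmoothOffZero.pdBase (hf : SmoothOffZero U f) (hU : IsOpen U) (i : Fin n) :
    SmoothOffZero U (pdBase i f) :=
  (hf.fderiv_apply hU (EuclideanSpace.single i 1, 0)).congr fun _ hx _ hξ =>
    lineDeriv_base_eq hf hU hx hξ _

theorem SmoothOffZero.pdFibre (hf : SmoothOffZero U f) (hU : IsOpen U) (i : Fin n) :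
    SmoothOffZero U (pdFibre i f) :=
  (hf.fderiv_apply hU (0, EuclideanSpace.single i 1)).congr fun _ hx _ hξ =>
    lineDeriv_fibre_eq hf hU hx hξ _

theorem SmoothOffZero.mul (hf : SmoothOffZero U f) (hg : SmoothOffZero U g) :
    SmoothOffZero U fun x ξ => f x ξ * g x ξ := ContDiffOn.mul hf hg

theorem SmoothOffZero.sum {f : Fin n → EuclideanSpace ℝ (Fin n) → EuclideanSpace ℝ (Fin n) → ℝ}
    (hf : ∀ j, SmoothOffZero U (f j)) : SmoothOffZero U fun x ξ => ∑ j, f j x ξ :=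
  ContDiffOn.sum fun j _ => hf j

theorem smoothOffZero_const (c : ℝ) : SmoothOffZero U fun _ _ => c := contDiffOn_const

theorem smoothOffZero_coord (j : Fin n) : SmoothOffZero U fun _ ξ => ξ j := by
  have : ContDiff ℝ ∞ (fun p : EuclideanSpace ℝ (Fin n) × EuclideanSpace ℝ (Fin n) => p.2 j) := by
    fun_prop
  exact this.contDiffOn

theorem pdBase_congr (hU : IsOpen U) (h : ∀ x ∈ U, ∀ ξ, ξ ≠ 0 → f x ξ = g x ξ)
    (hx : x ∈ U) (hξ : ξ ≠ 0) (i : Fin n) : pdBase i f x ξ = pdBase i g x ξ :=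
  Filter.EventuallyEq.lineDeriv_eq <| by
    filter_upwards [hU.mem_nhds hx] with y hy using h y hy ξ hξ

theorem pdFibre_congr (h : ∀ x ∈ U, ∀ ξ, ξ ≠ 0 → f x ξ = g x ξ)
    (hx : x ∈ U) (hξ : ξ ≠ 0) (i : Fin n) : pdFibre i f x ξ = pdFibre i g x ξ :=
  Filter.EventuallyEq.lineDeriv_eq <| by
    filter_upwards [isOpen_ne.mem_nhds hξ] with η hη using h x hx η hη

theorem pdBase_mul (hU : IsOpen U) (hf : SmoothOffZero U f) (hg : SmoothOffZero U g)
    (hx : x ∈ U) (hξ : ξ ≠ 0) (i : Fin n) :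
    pdBase i (fun x ξ => f x ξ * g x ξ) x ξ
      = pdBase i f x ξ * g x ξ + f x ξ * pdBase i g x ξ := by
  have h1 := ((hf.differentiableAt_base hU hx hξ).hasFDerivAt.mul
    (hg.differentiableAt_base hU hx hξ).hasFDerivAt).hasLineDerivAt (EuclideanSpace.single i 1)
  refine h1.lineDeriv.trans ?_
  simp only [pdBase, (hf.differentiableAt_base hU hx hξ).lineDeriv_eq_fderiv,
    (hg.differentiableAt_base hU hx hξ).lineDeriv_eq_fderiv, add_apply,
    smul_apply, smul_eq_mul]
  ring

theorem pdFibre_mul (hU : IsOpen U) (hf : SmoothOffZero U f) (hg : SmoothOffZero U g)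
    (hx : x ∈ U) (hξ : ξ ≠ 0) (i : Fin n) :
    pdFibre i (fun x ξ => f x ξ * g x ξ) x ξ
      = pdFibre i f x ξ * g x ξ + f x ξ * pdFibre i g x ξ := by
  have h1 := ((hf.differentiableAt_fibre hU hx hξ).hasFDerivAt.mul
    (hg.differentiableAt_fibre hU hx hξ).hasFDerivAt).hasLineDerivAt (EuclideanSpace.single i 1)
  refine h1.lineDeriv.trans ?_
  simp only [pdFibre, (hf.differentiableAt_fibre hU hx hξ).lineDeriv_eq_fderiv,
    (hg.differentiableAt_fibre hU hx hξ).lineDeriv_eq_fderiv, add_apply,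
    smul_apply, smul_eq_mul]
  ring

theorem pdBase_add (hU : IsOpen U) (hf : SmoothOffZero U f) (hg : SmoothOffZero U g)
    (hx : x ∈ U) (hξ : ξ ≠ 0) (i : Fin n) :
    pdBase i (fun x ξ => f x ξ + g x ξ) x ξ = pdBase i f x ξ + pdBase i g x ξ := by
  have h1 := ((hf.differentiableAt_base hU hx hξ).hasFDerivAt.add
    (hg.differentiableAt_base hU hx hξ).hasFDerivAt).hasLineDerivAt (EuclideanSpace.single i 1)
  refine h1.lineDeriv.trans ?_
  simp only [pdBase, (hf.differentiableAt_base hU hx hξ).lineDeriv_eq_fderiv,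
    (hg.differentiableAt_base hU hx hξ).lineDeriv_eq_fderiv, add_apply]

theorem pdFibre_add (hU : IsOpen U) (hf : SmoothOffZero U f) (hg : SmoothOffZero U g)
    (hx : x ∈ U) (hξ : ξ ≠ 0) (i : Fin n) :
    pdFibre i (fun x ξ => f x ξ + g x ξ) x ξ = pdFibre i f x ξ + pdFibre i g x ξ := by
  have h1 := ((hf.differentiableAt_fibre hU hx hξ).hasFDerivAt.add
    (hg.differentiableAt_fibre hU hx hξ).hasFDerivAt).hasLineDerivAt (EuclideanSpace.single i 1)
  refine h1.lineDeriv.trans ?_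
  simp only [pdFibre, (hf.differentiableAt_fibre hU hx hξ).lineDeriv_eq_fderiv,
    (hg.differentiableAt_fibre hU hx hξ).lineDeriv_eq_fderiv, add_apply]

theorem pdBase_sum {f : Fin n → EuclideanSpace ℝ (Fin n) → EuclideanSpace ℝ (Fin n) → ℝ}
    (hU : IsOpen U) (hf : ∀ j, SmoothOffZero U (f j)) (hx : x ∈ U) (hξ : ξ ≠ 0) (i : Fin n) :
    pdBase i (fun x ξ => ∑ j, f j x ξ) x ξ = ∑ j, pdBase i (f j) x ξ := by
  have h1 := (HasFDerivAt.fun_sum (u := Finset.univ) fun j _ =>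
    ((hf j).differentiableAt_base hU hx hξ).hasFDerivAt).hasLineDerivAt
      (EuclideanSpace.single i 1)
  refine h1.lineDeriv.trans ?_
  simp only [pdBase, ((hf _).differentiableAt_base hU hx hξ).lineDeriv_eq_fderiv,
    sum_apply]

theorem pdFibre_sum {f : Fin n → EuclideanSpace ℝ (Fin n) → EuclideanSpace ℝ (Fin n) → ℝ}
    (hU : IsOpen U) (hf : ∀ j, SmoothOffZero U (f j)) (hx : x ∈ U) (hξ : ξ ≠ 0) (i : Fin n) :
    pdFibre i (fun x ξ => ∑ j, f j x ξ) x ξ = ∑ j, pdFibre i (f j) x ξ := by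
  have h1 := (HasFDerivAt.fun_sum (u := Finset.univ) fun j _ =>
    ((hf j).differentiableAt_fibre hU hx hξ).hasFDerivAt).hasLineDerivAt
      (EuclideanSpace.single i 1)
  refine h1.lineDeriv.trans ?_
  simp only [pdFibre, ((hf _).differentiableAt_fibre hU hx hξ).lineDeriv_eq_fderiv,
    sum_apply]

theorem pdBase_fibreFun (φ : EuclideanSpace ℝ (Fin n) → ℝ) (i : Fin n) :
    pdBase i (fun _ ξ => φ ξ) x ξ = 0 := by
  simp [pdBase, lineDeriv]

theorem pdFibre_coord (i j : Fin n) :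
    pdFibre i (fun _ ξ => ξ j) x ξ = if j = i then 1 else 0 := by
  have h1 := ((EuclideanSpace.proj j : EuclideanSpace ℝ (Fin n) →L[ℝ] ℝ).hasFDerivAt
    (x := ξ)).hasLineDerivAt (EuclideanSpace.single i 1)
  refine h1.lineDeriv.trans ?_
  simp

theorem sum_mul_pdBase (hU : IsOpen U) (hf : SmoothOffZero U f) (hx : x ∈ U) (hξ : ξ ≠ 0)
    (v : EuclideanSpace ℝ (Fin n)) :
    ∑ j, v j * pdBase j f x ξ = lineDeriv ℝ (fun y => f y ξ) x v := by
  simp only [pdBase, (hf.differentiableAt_base hU hx hξ).lineDeriv_eq_fderiv]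
  conv_rhs => rw [← (EuclideanSpace.basisFun (Fin n) ℝ).sum_repr v]
  simp [map_sum]

theorem sum_mul_pdFibre (hU : IsOpen U) (hf : SmoothOffZero U f) (hx : x ∈ U) (hξ : ξ ≠ 0)
    (v : EuclideanSpace ℝ (Fin n)) :
    ∑ j, v j * pdFibre j f x ξ = lineDeriv ℝ (fun η => f x η) ξ v := by
  simp only [pdFibre, (hf.differentiableAt_fibre hU hx hξ).lineDeriv_eq_fderiv]
  conv_rhs => rw [← (EuclideanSpace.basisFun (Fin n) ℝ).sum_repr v]
  simp [map_sum]

/-- Schwarz's theorem for constant directions in the total space. -/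
theorem fderiv_fderiv_comm (hU : IsOpen U) (hf : SmoothOffZero U f) (hx : x ∈ U) (hξ : ξ ≠ 0)
    (v w : EuclideanSpace ℝ (Fin n) × EuclideanSpace ℝ (Fin n)) :
    fderiv ℝ (fun p => fderiv ℝ
      (fun p : EuclideanSpace ℝ (Fin n) × EuclideanSpace ℝ (Fin n) => f p.1 p.2) p v) (x, ξ) w =
    fderiv ℝ (fun p => fderiv ℝ
      (fun p : EuclideanSpace ℝ (Fin n) × EuclideanSpace ℝ (Fin n) => f p.1 p.2) p w) (x, ξ) v := by
  have h0 := hf.contDiffAt hU hx hξ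
  have hd : DifferentiableAt ℝ (fderiv ℝ
      (fun p : EuclideanSpace ℝ (Fin n) × EuclideanSpace ℝ (Fin n) => f p.1 p.2)) (x, ξ) :=
    (h0.fderiv_right (m := ∞) (by simp)).differentiableAt (by simp)
  have hs := h0.isSymmSndFDerivAt (by
    rw [minSmoothness_of_isRCLikeNormedField]; exact WithTop.coe_le_coe.2 le_top)
  rw [fderiv_clm_apply hd (differentiableAt_const v),
    fderiv_clm_apply hd (differentiableAt_const w)]
  simpa using hs w v

theorem pdFibre_pdFibre_comm (hU : IsOpen U) (hf : SmoothOffZero U f) (hx : x ∈ U) (hξ : ξ ≠ 0)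
    (i j : Fin n) : pdFibre i (pdFibre j f) x ξ = pdFibre j (pdFibre i f) x ξ := by
  have key : ∀ k : Fin n, ∀ x ∈ U, ∀ ξ, ξ ≠ 0 → pdFibre k f x ξ = fderiv ℝ
      (fun p : EuclideanSpace ℝ (Fin n) × EuclideanSpace ℝ (Fin n) => f p.1 p.2) (x, ξ)
      (0, EuclideanSpace.single k 1) := fun k x hx ξ hξ => lineDeriv_fibre_eq hf hU hx hξ _
  rw [pdFibre_congr (key j) hx hξ, pdFibre_congr (key i) hx hξ]
  exact (lineDeriv_fibre_eq (hf.fderiv_apply hU _) hU hx hξ _).trans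
    ((fderiv_fderiv_comm hU hf hx hξ _ _).trans
      (lineDeriv_fibre_eq (hf.fderiv_apply hU _) hU hx hξ _).symm)

theorem pdBase_pdBase_comm (hU : IsOpen U) (hf : SmoothOffZero U f) (hx : x ∈ U) (hξ : ξ ≠ 0)
    (i j : Fin n) : pdBase i (pdBase j f) x ξ = pdBase j (pdBase i f) x ξ := by
  have key : ∀ k : Fin n, ∀ x ∈ U, ∀ ξ, ξ ≠ 0 → pdBase k f x ξ = fderiv ℝ
      (fun p : EuclideanSpace ℝ (Fin n) × EuclideanSpace ℝ (Fin n) => f p.1 p.2) (x, ξ)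
      (EuclideanSpace.single k 1, 0) := fun k x hx ξ hξ => lineDeriv_base_eq hf hU hx hξ _
  rw [pdBase_congr hU (key j) hx hξ, pdBase_congr hU (key i) hx hξ]
  exact (lineDeriv_base_eq (hf.fderiv_apply hU _) hU hx hξ _).trans
    ((fderiv_fderiv_comm hU hf hx hξ _ _).trans
      (lineDeriv_base_eq (hf.fderiv_apply hU _) hU hx hξ _).symm)

theorem pdFibre_pdBase_comm (hU : IsOpen U) (hf : SmoothOffZero U f) (hx : x ∈ U) (hξ : ξ ≠ 0)
    (i j : Fin n) : pdFibre i (pdBase j f) x ξ = pdBase j (pdFibre i f) x ξ := by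
  have keyB : ∀ x ∈ U, ∀ ξ, ξ ≠ 0 → pdBase j f x ξ = fderiv ℝ
      (fun p : EuclideanSpace ℝ (Fin n) × EuclideanSpace ℝ (Fin n) => f p.1 p.2) (x, ξ)
      (EuclideanSpace.single j 1, 0) := fun x hx ξ hξ => lineDeriv_base_eq hf hU hx hξ _
  have keyF : ∀ x ∈ U, ∀ ξ, ξ ≠ 0 → pdFibre i f x ξ = fderiv ℝ
      (fun p : EuclideanSpace ℝ (Fin n) × EuclideanSpace ℝ (Fin n) => f p.1 p.2) (x, ξ)
      (0, EuclideanSpace.single i 1) := fun x hx ξ hξ => lineDeriv_fibre_eq hf hU hx hξ _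
  rw [pdFibre_congr keyB hx hξ, pdBase_congr hU keyF hx hξ]
  exact (lineDeriv_fibre_eq (hf.fderiv_apply hU _) hU hx hξ _).trans
    ((fderiv_fderiv_comm hU hf hx hξ _ _).trans
      (lineDeriv_base_eq (hf.fderiv_apply hU _) hU hx hξ _).symm)

end Calculus

/-! ### Projectively flat Finsler metrics -/

section ProjectivelyFlat

variable {n : ℕ} {U : Set (EuclideanSpace ℝ (Fin n))}
  {F P : EuclideanSpace ℝ (Fin n) → EuclideanSpace ℝ (Fin n) → ℝ}
  {x ξ : EuclideanSpace ℝ (Fin n)}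

theorem IsFinslerOn.smoothOffZero (hF : IsFinslerOn U F) : SmoothOffZero U F := hF.smooth

/-- Euler's identity `ξʲ F_{ξʲ} = F`. -/
theorem IsFinslerOn.euler (hF : IsFinslerOn U F) (hU : IsOpen U) (hx : x ∈ U) (hξ : ξ ≠ 0) :
    ∑ j, ξ j * pdFibre j F x ξ = F x ξ := by
  rw [sum_mul_pdFibre hU hF.smoothOffZero hx hξ]
  have h1 : HasDerivAt (fun t : ℝ => (1 + t) * F x ξ) (F x ξ) 0 := by
    simpa using ((hasDerivAt_id (0 : ℝ)).const_add 1).mul_const (F x ξ)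
  refine (h1.congr_of_eventuallyEq ?_).deriv
  filter_upwards [Ioi_mem_nhds (show (-1 : ℝ) < 0 by norm_num)] with t ht
  have ht' : 0 < 1 + t := by linarith [Set.mem_Ioi.1 ht]
  rw [← hF.homogeneous x hx ξ _ ht', add_smul, one_smul]

theorem pdFibre_sum_coord_mul {f : Fin n → EuclideanSpace ℝ (Fin n) → EuclideanSpace ℝ (Fin n) → ℝ}
    (hU : IsOpen U) (hf : ∀ j, SmoothOffZero U (f j)) (hx : x ∈ U) (hξ : ξ ≠ 0) (k : Fin n) :
    pdFibre k (fun x ξ => ∑ j, ξ j * f j x ξ) x ξ =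
      f k x ξ + ∑ j, ξ j * pdFibre k (f j) x ξ := by
  rw [pdFibre_sum hU (fun j => (smoothOffZero_coord j).mul (hf j)) hx hξ]
  simp_rw [fun j => pdFibre_mul hU (smoothOffZero_coord (U := U) j) (hf j) hx hξ k, pdFibre_coord]
  simp [Finset.sum_add_distrib]

theorem pdBase_sum_coord_mul {f : Fin n → EuclideanSpace ℝ (Fin n) → EuclideanSpace ℝ (Fin n) → ℝ}
    (hU : IsOpen U) (hf : ∀ j, SmoothOffZero U (f j)) (hx : x ∈ U) (hξ : ξ ≠ 0) (k : Fin n) :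
    pdBase k (fun x ξ => ∑ j, ξ j * f j x ξ) x ξ = ∑ j, ξ j * pdBase k (f j) x ξ := by
  rw [pdBase_sum hU (fun j => (smoothOffZero_coord j).mul (hf j)) hx hξ]
  refine Finset.sum_congr rfl fun j _ => ?_
  rw [pdBase_mul hU (smoothOffZero_coord (U := U) j) (hf j) hx hξ k,
    pdBase_fibreFun (fun ξ : EuclideanSpace ℝ (Fin n) => ξ j) k]
  ring

/-- The fibre derivatives of a function of degree `1` have degree `0`. -/
theorem sum_mul_pdFibre_pdFibre_eq_zero (hU : IsOpen U) {f : EuclideanSpace ℝ (Fin n) →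
    EuclideanSpace ℝ (Fin n) → ℝ} (hf : SmoothOffZero U f)
    (h : ∀ x ∈ U, ∀ ξ, ξ ≠ 0 → ∑ j, ξ j * pdFibre j f x ξ = f x ξ) (hx : x ∈ U) (hξ : ξ ≠ 0)
    (k : Fin n) : ∑ j, ξ j * pdFibre j (pdFibre k f) x ξ = 0 := by
  have h1 := pdFibre_congr h hx hξ k
  rw [pdFibre_sum_coord_mul hU (fun j => hf.pdFibre hU j) hx hξ] at h1
  simp_rw [fun j => pdFibre_pdFibre_comm hU hf hx hξ j k]
  linarith

theorem fundamentalTensor_eq (hF : SmoothOffZero U F) (hU : IsOpen U) (hx : x ∈ U) (hξ : ξ ≠ 0)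
    (i j : Fin n) : fundamentalTensor F x ξ i j =
      pdFibre i F x ξ * pdFibre j F x ξ + F x ξ * pdFibre i (pdFibre j F) x ξ := by
  have h1 : ∀ x ∈ U, ∀ ξ, ξ ≠ 0 →
      pdFibre j (sq F) x ξ = 2 * (F x ξ * pdFibre j F x ξ) := fun x hx ξ hξ => by
    rw [pdFibre_congr (f := sq F) (g := fun x ξ => F x ξ * F x ξ) (fun _ _ _ _ => pow_two _) hx hξ,
      pdFibre_mul hU hF hF hx hξ]
    ring
  simp only [fundamentalTensor, Matrix.of_apply]
  rw [pdFibre_congr h1 hx hξ,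
    pdFibre_mul hU (smoothOffZero_const 2) (hF.mul (hF.pdFibre hU j)) hx hξ,
    pdFibre_mul hU hF (hF.pdFibre hU j) hx hξ]
  have h2 : pdFibre i (fun _ _ => (2 : ℝ)) x ξ = 0 := by simp [pdFibre, lineDeriv]
  rw [h2]
  ring

theorem IsFinslerOn.sum_fundamentalTensor_mul (hF : IsFinslerOn U F) (hU : IsOpen U) (hx : x ∈ U)
    (hξ : ξ ≠ 0) (i : Fin n) :
    ∑ j, fundamentalTensor F x ξ i j * ξ j = F x ξ * pdFibre i F x ξ := by
  have h0 := hF.euler hU hx hξ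
  have h1 := sum_mul_pdFibre_pdFibre_eq_zero hU hF.smoothOffZero
    (fun x hx ξ hξ => hF.euler hU hx hξ) hx hξ i
  calc ∑ j, fundamentalTensor F x ξ i j * ξ j
      = ∑ j, (pdFibre i F x ξ * (ξ j * pdFibre j F x ξ)
          + F x ξ * (ξ j * pdFibre j (pdFibre i F) x ξ)) :=
        Finset.sum_congr rfl fun j _ => by
          rw [fundamentalTensor_eq hF.smoothOffZero hU hx hξ,
            pdFibre_pdFibre_comm hU hF.smoothOffZero hx hξ i j]
          ring
    _ = F x ξ * pdFibre i F x ξ := by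
        rw [Finset.sum_add_distrib, ← Finset.mul_sum, ← Finset.mul_sum, h0, h1]
        ring

theorem gInner_eq_dotProduct (u v : EuclideanSpace ℝ (Fin n)) :
    gInner F x ξ u v = ∑ i, u i * ∑ j, fundamentalTensor F x ξ i j * v j := by
  simp only [gInner, Finset.mul_sum]
  exact Finset.sum_congr rfl fun i _ => Finset.sum_congr rfl fun j _ => by ring

theorem IsFinslerOn.gInner_pos (hF : IsFinslerOn U F) (hx : x ∈ U) (hξ : ξ ≠ 0)
    {v : EuclideanSpace ℝ (Fin n)} (hv : v ≠ 0) : 0 < gInner F x ξ v v := by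
  have h := (hF.posDef x hx ξ hξ).dotProduct_mulVec_pos (x := v.ofLp)
    (fun h => hv (by ext i; simpa using congrFun h i))
  rw [gInner_eq_dotProduct]
  simpa [dotProduct, Matrix.mulVec] using h

/-- `g_ξ(u, ξ) = F · F_{ξⁱ} uⁱ`. -/
theorem IsFinslerOn.gInner_right_self (hF : IsFinslerOn U F) (hU : IsOpen U) (hx : x ∈ U)
    (hξ : ξ ≠ 0) (u : EuclideanSpace ℝ (Fin n)) :
    gInner F x ξ u ξ = F x ξ * ∑ i, pdFibre i F x ξ * u i := by
  rw [gInner_eq_dotProduct, Finset.mul_sum]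
  exact Finset.sum_congr rfl fun i _ => by
    rw [hF.sum_fundamentalTensor_mul hU hx hξ]; ring

theorem IsFinslerOn.gInner_comm (hF : IsFinslerOn U F) (hx : x ∈ U)
    (hξ : ξ ≠ 0) (u v : EuclideanSpace ℝ (Fin n)) :
    gInner F x ξ u v = gInner F x ξ v u := by
  have hs : ∀ i j, fundamentalTensor F x ξ i j = fundamentalTensor F x ξ j i := fun i j => by
    simpa using ((hF.posDef x hx ξ hξ).isHermitian.apply i j).symm
  simp only [gInner]
  rw [Finset.sum_comm]
  exact Finset.sum_congr rfl fun i _ => Finset.sum_congr rfl fun j _ => by rw [hs]; ring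

theorem gInner_add_smul_left (u v w : EuclideanSpace ℝ (Fin n)) (c : ℝ) :
    gInner F x ξ (u + c • v) w = gInner F x ξ u w + c * gInner F x ξ v w := by
  simp only [gInner_eq_dotProduct, PiLp.add_apply, PiLp.smul_apply, smul_eq_mul, add_mul,
    Finset.sum_add_distrib, Finset.mul_sum]
  simp only [mul_assoc]

theorem IsFinslerOn.gInner_self_self (hF : IsFinslerOn U F) (hU : IsOpen U) (hx : x ∈ U)
    (hξ : ξ ≠ 0) : gInner F x ξ ξ ξ = F x ξ ^ 2 := by
  rw [hF.gInner_right_self hU hx hξ, pow_two, ← hF.euler hU hx hξ]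
  simp only [mul_comm]

theorem IsFinslerOn.pos (hF : IsFinslerOn U F) (hU : IsOpen U) (hx : x ∈ U)
    (hξ : ξ ≠ 0) : 0 < F x ξ := by
  have h := hF.gInner_pos hx hξ hξ
  rw [hF.gInner_self_self hU hx hξ] at h
  exact (hF.nonneg x hx ξ).lt_of_ne' (by rintro h0; simp [h0] at h)

/-- `P` is a projective factor of `F`: Hamel's equations `ξʲ F_{xʲ ξᵏ} = F_{xᵏ}` hold, so that
the geodesics of `F` are straight lines, and `ξʲ F_{xʲ} = 2 F P`. -/
structure IsProjectiveFactor (U : Set (EuclideanSpace ℝ (Fin n)))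
    (F P : EuclideanSpace ℝ (Fin n) → EuclideanSpace ℝ (Fin n) → ℝ) : Prop where
  hamel : ∀ x ∈ U, ∀ ξ, ξ ≠ 0 → ∀ k, ∑ j, ξ j * pdBase j (pdFibre k F) x ξ = pdBase k F x ξ
  geodesic : ∀ x ∈ U, ∀ ξ, ξ ≠ 0 → ∑ j, ξ j * pdBase j F x ξ = 2 * (F x ξ * P x ξ)

theorem IsProjectiveFactor.smooth (hP : IsProjectiveFactor U F P) (hF : IsFinslerOn U F)
    (hU : IsOpen U) : SmoothOffZero U P := by
  have h1 : SmoothOffZero U fun x ξ => ∑ j, ξ j * pdBase j F x ξ :=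
    SmoothOffZero.sum fun j => (smoothOffZero_coord j).mul (hF.smoothOffZero.pdBase hU j)
  have h2 : SmoothOffZero U fun x ξ => (∑ j, ξ j * pdBase j F x ξ) / (2 * F x ξ) :=
    ContDiffOn.div h1 ((smoothOffZero_const 2).mul hF.smoothOffZero) fun p hp =>
      (mul_pos two_pos (hF.pos hU hp.1 hp.2)).ne'
  refine h2.congr fun x hx ξ hξ => ?_
  rw [hP.geodesic x hx ξ hξ]
  field_simp [(hF.pos hU hx hξ).ne']

/-- `F_{xᵏ} = (P F)_{ξᵏ}`. -/
theorem IsProjectiveFactor.pdBase_eq (hP : IsProjectiveFactor U F P) (hF : IsFinslerOn U F)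
    (hU : IsOpen U) (hx : x ∈ U) (hξ : ξ ≠ 0) (k : Fin n) :
    pdBase k F x ξ = pdFibre k F x ξ * P x ξ + F x ξ * pdFibre k P x ξ := by
  have hFs := hF.smoothOffZero
  have h1 := pdFibre_congr hP.geodesic hx hξ k
  rw [pdFibre_sum_coord_mul hU (fun j => hFs.pdBase hU j) hx hξ,
    pdFibre_mul hU (smoothOffZero_const 2) (hFs.mul (hP.smooth hF hU)) hx hξ,
    pdFibre_mul hU hFs (hP.smooth hF hU) hx hξ] at h1
  simp_rw [fun j => pdFibre_pdBase_comm hU hFs hx hξ k j] at h1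
  rw [hP.hamel x hx ξ hξ] at h1
  have h2 : pdFibre k (fun _ _ => (2 : ℝ)) x ξ = 0 := by simp [pdFibre, lineDeriv]
  rw [h2] at h1
  linarith

theorem IsProjectiveFactor.euler (hP : IsProjectiveFactor U F P) (hF : IsFinslerOn U F)
    (hU : IsOpen U) (hx : x ∈ U) (hξ : ξ ≠ 0) : ∑ j, ξ j * pdFibre j P x ξ = P x ξ := by
  have h1 := hP.geodesic x hx ξ hξ
  simp_rw [fun j => hP.pdBase_eq hF hU hx hξ j] at h1
  have h2 : ∑ j, ξ j * (pdFibre j F x ξ * P x ξ + F x ξ * pdFibre j P x ξ) =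
      (∑ j, ξ j * pdFibre j F x ξ) * P x ξ + F x ξ * ∑ j, ξ j * pdFibre j P x ξ := by
    rw [Finset.sum_mul, Finset.mul_sum, ← Finset.sum_add_distrib]
    exact Finset.sum_congr rfl fun j _ => by ring
  rw [h2, hF.euler hU hx hξ] at h1
  exact mul_left_cancel₀ (hF.pos hU hx hξ).ne' (by linarith)

/-- The spray of a projectively flat metric is radial. -/
theorem IsProjectiveFactor.spray_eq (hP : IsProjectiveFactor U F P) (hF : IsFinslerOn U F)
    (hU : IsOpen U) (hx : x ∈ U) (hξ : ξ ≠ 0) (i : Fin n) : spray F i x ξ = P x ξ * ξ i := by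
  have hFs := hF.smoothOffZero
  have hsq : ∀ k, ∀ x ∈ U, ∀ ξ, ξ ≠ 0 →
      pdBase k (sq F) x ξ = 2 * (F x ξ * pdBase k F x ξ) := fun k x hx ξ hξ => by
    rw [pdBase_congr hU (f := sq F) (g := fun x ξ => F x ξ * F x ξ)
        (fun _ _ _ _ => pow_two _) hx hξ,
      pdBase_mul hU hFs hFs hx hξ]
    ring
  have h2 : ∀ l, pdFibre l (fun _ _ => (2 : ℝ)) x ξ = 0 := by simp [pdFibre, lineDeriv]
  have hrhs : ∀ l, (∑ k, pdFibre l (pdBase k (sq F)) x ξ * ξ k) - pdBase l (sq F) x ξ =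
      ∑ m, fundamentalTensor F x ξ l m * (4 * P x ξ * ξ m) := fun l => by
    have hg : ∑ m, fundamentalTensor F x ξ l m * (4 * P x ξ * ξ m) =
        4 * P x ξ * (F x ξ * pdFibre l F x ξ) := by
      rw [← hF.sum_fundamentalTensor_mul hU hx hξ, Finset.mul_sum]
      exact Finset.sum_congr rfl fun m _ => by ring
    have hl : ∑ k, pdFibre l (pdBase k (sq F)) x ξ * ξ k =
        2 * pdFibre l F x ξ * (∑ k, ξ k * pdBase k F x ξ)
          + 2 * F x ξ * ∑ k, ξ k * pdBase k (pdFibre l F) x ξ := by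
      rw [Finset.mul_sum, Finset.mul_sum, ← Finset.sum_add_distrib]
      refine Finset.sum_congr rfl fun k _ => ?_
      rw [pdFibre_congr (hsq k) hx hξ,
        pdFibre_mul hU (smoothOffZero_const 2) (hFs.mul (hFs.pdBase hU k)) hx hξ,
        pdFibre_mul hU hFs (hFs.pdBase hU k) hx hξ, h2, pdFibre_pdBase_comm hU hFs hx hξ]
      ring
    rw [hg, hl, hsq l x hx ξ hξ, hP.geodesic x hx ξ hξ, hP.hamel x hx ξ hξ]
    ring
  -- `g (4 P ξ)` is the covector in the definition of the spray, so `g⁻¹` of it is `4 P ξ`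
  have hdet : IsUnit (fundamentalTensor F x ξ).det :=
    (hF.posDef x hx ξ hξ).det_pos.ne'.isUnit
  have hinv : (fundamentalTensor F x ξ)⁻¹.mulVec
      ((fundamentalTensor F x ξ).mulVec fun m => 4 * P x ξ * ξ m) = fun m => 4 * P x ξ * ξ m := by
    rw [Matrix.mulVec_mulVec, Matrix.nonsing_inv_mul _ hdet, Matrix.one_mulVec]
  have h3 := congrFun hinv i
  simp only [Matrix.mulVec, dotProduct] at h3
  simp only [spray, hrhs, h3]
  ring

/-- `K F² = P² - ξʲ P_{xʲ}`: the common value of the flag curvatures, times `F²`, of a metric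
with projective factor `P`. -/
noncomputable def flatCurvature (P : EuclideanSpace ℝ (Fin n) → EuclideanSpace ℝ (Fin n) → ℝ)
    (x ξ : EuclideanSpace ℝ (Fin n)) : ℝ :=
  P x ξ ^ 2 - ∑ j, ξ j * pdBase j P x ξ

/-- The compatibility of `ξʲ F_{xʲ} = 2 F P` with `F_{xᵏ} = (P F)_{ξᵏ}`; it determines the part of
the curvature proportional to `ξ`. -/
theorem IsProjectiveFactor.compat (hP : IsProjectiveFactor U F P) (hF : IsFinslerOn U F)
    (hU : IsOpen U) (hx : x ∈ U) (hξ : ξ ≠ 0) (k : Fin n) :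
    F x ξ * (2 * pdBase k P x ξ - ∑ j, ξ j * pdBase j (pdFibre k P) x ξ
      - P x ξ * pdFibre k P x ξ) = -(flatCurvature P x ξ * pdFibre k F x ξ) := by
  have hFs := hF.smoothOffZero
  have hPs := hP.smooth hF hU
  have h2 : pdBase k (fun _ _ => (2 : ℝ)) x ξ = 0 := by simp [pdBase, lineDeriv]
  have h1 := pdBase_congr hU hP.geodesic hx hξ k
  rw [pdBase_sum_coord_mul hU (fun j => hFs.pdBase hU j) hx hξ,
    pdBase_mul hU (smoothOffZero_const 2) (hFs.mul hPs) hx hξ,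
    pdBase_mul hU hFs hPs hx hξ, h2] at h1
  -- commute the two base derivatives and insert `F_{xᵏ} = (P F)_{ξᵏ}`
  have h3 : ∑ j, ξ j * pdBase k (pdBase j F) x ξ =
      (∑ j, ξ j * pdBase j (pdFibre k F) x ξ) * P x ξ
        + pdFibre k F x ξ * (∑ j, ξ j * pdBase j P x ξ)
        + (∑ j, ξ j * pdBase j F x ξ) * pdFibre k P x ξ
        + F x ξ * ∑ j, ξ j * pdBase j (pdFibre k P) x ξ := by
    rw [Finset.sum_mul, Finset.mul_sum, Finset.sum_mul, Finset.mul_sum,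
      ← Finset.sum_add_distrib, ← Finset.sum_add_distrib, ← Finset.sum_add_distrib]
    refine Finset.sum_congr rfl fun j _ => ?_
    rw [pdBase_pdBase_comm hU hFs hx hξ,
      pdBase_congr hU (fun x hx ξ hξ => hP.pdBase_eq hF hU hx hξ k) hx hξ,
      pdBase_add hU ((hFs.pdFibre hU k).mul hPs) (hFs.mul (hPs.pdFibre hU k)) hx hξ,
      pdBase_mul hU (hFs.pdFibre hU k) hPs hx hξ, pdBase_mul hU hFs (hPs.pdFibre hU k) hx hξ]
    ring
  rw [h3, hP.hamel x hx ξ hξ, hP.geodesic x hx ξ hξ] at h1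
  have h4 := hP.pdBase_eq hF hU hx hξ k
  simp only [flatCurvature]
  linear_combination -h1 - P x ξ * h4

/-- A projectively flat Finsler metric has `Rⁱ_k = (P² - ξʲ P_{xʲ}) (δⁱ_k - F⁻¹ F_{ξᵏ} ξⁱ)`. -/
theorem IsProjectiveFactor.riemannCurvature_eq (hP : IsProjectiveFactor U F P)
    (hF : IsFinslerOn U F) (hU : IsOpen U) (hx : x ∈ U) (hξ : ξ ≠ 0) (i k : Fin n) :
    riemannCurvature F i k x ξ = flatCurvature P x ξ *
      ((if i = k then 1 else 0) - pdFibre k F x ξ / F x ξ * ξ i) := by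
  have hPs := hP.smooth hF hU
  have hc : ∀ i, SmoothOffZero U fun _ ξ => ξ i := smoothOffZero_coord
  have hs : ∀ i, ∀ x ∈ U, ∀ ξ, ξ ≠ 0 → spray F i x ξ = P x ξ * ξ i :=
    fun i x hx ξ hξ => hP.spray_eq hF hU hx hξ i
  have hb : pdBase k (spray F i) x ξ = pdBase k P x ξ * ξ i := by
    rw [pdBase_congr hU (hs i) hx hξ, pdBase_mul hU hPs (hc i) hx hξ,
      pdBase_fibreFun (fun ξ : EuclideanSpace ℝ (Fin n) => ξ i)]
    ring
  have hf : ∀ i k, ∀ x ∈ U, ∀ ξ, ξ ≠ 0 → pdFibre k (spray F i) x ξ =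
      pdFibre k P x ξ * ξ i + P x ξ * (if i = k then 1 else 0) := fun i k x hx ξ hξ => by
    rw [pdFibre_congr (hs i) hx hξ, pdFibre_mul hU hPs (hc i) hx hξ, pdFibre_coord]
  have h1s : SmoothOffZero U fun x ξ => pdFibre k P x ξ * ξ i := (hPs.pdFibre hU k).mul (hc i)
  have hks : SmoothOffZero U fun _ _ => (if i = k then 1 else 0 : ℝ) := smoothOffZero_const _
  have hbf : ∀ j, pdBase j (pdFibre k (spray F i)) x ξ =
      pdBase j (pdFibre k P) x ξ * ξ i + pdBase j P x ξ * (if i = k then 1 else 0) := fun j => by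
    have h0 : pdBase j (fun _ _ => (if i = k then 1 else 0 : ℝ)) x ξ = 0 := by
      simp [pdBase, lineDeriv]
    rw [pdBase_congr hU (hf i k) hx hξ, pdBase_add hU h1s (hPs.mul hks) hx hξ,
      pdBase_mul hU (hPs.pdFibre hU k) (hc i) hx hξ, pdBase_mul hU hPs hks hx hξ,
      pdBase_fibreFun (fun ξ : EuclideanSpace ℝ (Fin n) => ξ i), h0]
    ring
  have hff : ∀ j, pdFibre j (pdFibre k (spray F i)) x ξ =
      pdFibre j (pdFibre k P) x ξ * ξ i + pdFibre k P x ξ * (if i = j then 1 else 0)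
        + pdFibre j P x ξ * (if i = k then 1 else 0) := fun j => by
    have h0 : pdFibre j (fun _ _ => (if i = k then 1 else 0 : ℝ)) x ξ = 0 := by
      simp [pdFibre, lineDeriv]
    rw [pdFibre_congr (hf i k) hx hξ, pdFibre_add hU h1s (hPs.mul hks) hx hξ,
      pdFibre_mul hU (hPs.pdFibre hU k) (hc i) hx hξ, pdFibre_mul hU hPs hks hx hξ,
      pdFibre_coord, h0]
    ring
  have hE := hP.euler hF hU hx hξ
  have hE0 := sum_mul_pdFibre_pdFibre_eq_zero hU hPs (fun x hx ξ hξ => hP.euler hF hU hx hξ) hx hξ k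
  have s1 : ∑ j, ξ j * pdBase j (pdFibre k (spray F i)) x ξ =
      (∑ j, ξ j * pdBase j (pdFibre k P) x ξ) * ξ i
        + (∑ j, ξ j * pdBase j P x ξ) * (if i = k then 1 else 0) := by
    rw [Finset.sum_mul, Finset.sum_mul, ← Finset.sum_add_distrib]
    exact Finset.sum_congr rfl fun j _ => by rw [hbf]; ring
  have s2 : ∑ j, spray F j x ξ * pdFibre j (pdFibre k (spray F i)) x ξ =
      P x ξ * (∑ j, ξ j * pdFibre j (pdFibre k P) x ξ) * ξ i
        + P x ξ * pdFibre k P x ξ * ξ i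
        + P x ξ * (∑ j, ξ j * pdFibre j P x ξ) * (if i = k then 1 else 0) := by
    have h5 : P x ξ * pdFibre k P x ξ * ξ i =
        ∑ j, P x ξ * pdFibre k P x ξ * (ξ j * (if i = j then 1 else 0)) := by
      rw [← Finset.mul_sum]; simp
    rw [h5, Finset.mul_sum, Finset.sum_mul, Finset.mul_sum, Finset.sum_mul,
      ← Finset.sum_add_distrib, ← Finset.sum_add_distrib]
    exact Finset.sum_congr rfl fun j _ => by rw [hff, hs j x hx ξ hξ]; ring
  have s3 : ∑ j, pdFibre j (spray F i) x ξ * pdFibre k (spray F j) x ξ =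
      (∑ j, ξ j * pdFibre j P x ξ) * pdFibre k P x ξ * ξ i
        + 2 * P x ξ * pdFibre k P x ξ * ξ i + P x ξ ^ 2 * (if i = k then 1 else 0) := by
    simp_rw [fun i k => hf i k x hx ξ hξ, add_mul, mul_add, Finset.sum_add_distrib]
    simp only [mul_ite, ite_mul, mul_one, mul_zero, zero_mul, Finset.sum_ite_eq,
      Finset.sum_ite_eq', Finset.mem_univ, if_true, Finset.sum_mul]
    have h6 : ∑ j, pdFibre j P x ξ * ξ i * (pdFibre k P x ξ * ξ j) =
      ∑ j, ξ j * pdFibre j P x ξ * pdFibre k P x ξ * ξ i :=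
        Finset.sum_congr rfl fun j _ => by ring
    rw [h6]
    split_ifs <;> ring
  have hFp := (hF.pos hU hx hξ).ne'
  -- the coefficient of `ξⁱ` left by Euler's identities is `-Ξ F_{ξᵏ} / F`
  have hk := hP.compat hF hU hx hξ k
  have hk' : 2 * pdBase k P x ξ - ∑ j, ξ j * pdBase j (pdFibre k P) x ξ
      - P x ξ * pdFibre k P x ξ = -(flatCurvature P x ξ * (pdFibre k F x ξ / F x ξ)) := by
    field_simp
    linarith
  have hfc : flatCurvature P x ξ = P x ξ ^ 2 - ∑ j, ξ j * pdBase j P x ξ := rfl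
  rw [riemannCurvature, hb, s1, s2, s3, hE, hE0]
  linear_combination ξ i * hk' - (if i = k then 1 else 0) * hfc

theorem IsProjectiveFactor.ricciCurvature_eq (hP : IsProjectiveFactor U F P)
    (hF : IsFinslerOn U F) (hU : IsOpen U) (hx : x ∈ U) (hξ : ξ ≠ 0) :
    ricciCurvature F x ξ = (n - 1) * flatCurvature P x ξ := by
  have hFp := (hF.pos hU hx hξ).ne'
  have h1 : ∑ i, pdFibre i F x ξ / F x ξ * ξ i = 1 := by
    rw [← div_self hFp]
    nth_rewrite 2 [← hF.euler hU hx hξ]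
    rw [Finset.sum_div]
    exact Finset.sum_congr rfl fun i _ => by ring
  simp only [ricciCurvature, fun i => hP.riemannCurvature_eq hF hU hx hξ i i]
  rw [← Finset.mul_sum, Finset.sum_sub_distrib, h1]
  simp
  ring

theorem IsProjectiveFactor.flagCurvature_mul_sq (hP : IsProjectiveFactor U F P)
    (hF : IsFinslerOn U F) (hU : IsOpen U) (hx : x ∈ U) (hξ : ξ ≠ 0)
    {u : EuclideanSpace ℝ (Fin n)} (hu : LinearIndependent ℝ ![ξ, u]) :
    flagCurvature F x ξ u * F x ξ ^ 2 = flatCurvature P x ξ := by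
  have hFp := hF.pos hU hx hξ
  set L := ∑ i, pdFibre i F x ξ * u i with hL
  have huξ : gInner F x ξ u ξ = F x ξ * L := hF.gInner_right_self hU hx hξ u
  have hξu : gInner F x ξ ξ u = F x ξ * L := (hF.gInner_comm hx hξ ξ u).trans huξ
  have hξξ := hF.gInner_self_self hU hx hξ
  have hR : riemannMap F x ξ u =
      0 + flatCurvature P x ξ • (u + (-(L / F x ξ)) • ξ) := by
    ext i
    have h1 : ∑ k, pdFibre k F x ξ / F x ξ * ξ i * u k = L / F x ξ * ξ i := by
      rw [hL, Finset.sum_div, Finset.sum_mul]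
      exact Finset.sum_congr rfl fun k _ => by ring
    simp only [riemannMap, fun k => hP.riemannCurvature_eq hF hU hx hξ i k, mul_assoc,
      ← Finset.mul_sum, sub_mul, Finset.sum_sub_distrib]
    simp only [← mul_assoc, h1]
    simp
    ring
  have h0 : gInner F x ξ 0 u = 0 := by simp [gInner]
  -- the component of `u` orthogonal to `ξ` is nonzero
  have hne : u + (-(L / F x ξ)) • ξ ≠ 0 := by
    intro h
    have := LinearIndependent.pair_iff.1 hu (-(L / F x ξ)) 1 (by rw [one_smul, add_comm]; exact h)
    exact one_ne_zero this.2
  have hpos := hF.gInner_pos hx hξ hne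
  have hw : ∀ w, gInner F x ξ (u + (-(L / F x ξ)) • ξ) w =
      gInner F x ξ u w - L / F x ξ * gInner F x ξ ξ w := fun w => by
    rw [gInner_add_smul_left]; ring
  rw [hw, hF.gInner_comm hx hξ u, hF.gInner_comm hx hξ ξ, hw, hw, hξu, huξ, hξξ] at hpos
  have hpos' : 0 < gInner F x ξ u u - L ^ 2 := by
    have e : gInner F x ξ u u - L / F x ξ * (F x ξ * L) -
      L / F x ξ * (F x ξ * L - L / F x ξ * F x ξ ^ 2) = gInner F x ξ u u - L ^ 2 := by
      field_simp; ring
    rwa [e] at hpos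
  have hden : F x ξ ^ 2 * gInner F x ξ u u - (F x ξ * L) ^ 2 ≠ 0 := by
    have := mul_pos (pow_pos hFp 2) hpos'
    exact ne_of_gt (by linarith)
  rw [flagCurvature, hR, gInner_add_smul_left, hw, h0, hξξ, hξu]
  field_simp
  ring

end ProjectivelyFlat

/-! ### Derivatives and positivity of the Funk–Finsler metric -/

section Funk

variable {ε r : ℝ} {x ξ v : EuclideanSpace ℝ (Fin 2)}

/-- The quadratic form `(r² - |x|²)|ξ|² + ⟨x, ξ⟩²`, which is `(r² - |x|²)² α²`. -/
noncomputable def kleinForm (r : ℝ) (x ξ : EuclideanSpace ℝ (Fin 2)) : ℝ :=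
  (r ^ 2 - ‖x‖ ^ 2) * ‖ξ‖ ^ 2 + inner ℝ x ξ ^ 2

theorem alpha_eq : alpha r x ξ = √(kleinForm r x ξ) / (r ^ 2 - ‖x‖ ^ 2) := rfl

theorem kleinForm_pos (hx : 0 < r ^ 2 - ‖x‖ ^ 2) (hξ : ξ ≠ 0) : 0 < kleinForm r x ξ :=
  add_pos_of_pos_of_nonneg (mul_pos hx (pow_pos (norm_pos_iff.2 hξ) 2)) (sq_nonneg _)

theorem hasDerivAt_line (x v : EuclideanSpace ℝ (Fin 2)) :
    HasDerivAt (fun t : ℝ => x + t • v) v 0 := by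
  simpa using ((hasDerivAt_id (0 : ℝ)).smul_const v).const_add x

theorem hasDerivAt_normSq_line (x v : EuclideanSpace ℝ (Fin 2)) :
    HasDerivAt (fun t : ℝ => ‖x + t • v‖ ^ 2) (2 * inner ℝ x v) 0 := by
  simpa using (hasDerivAt_line x v).norm_sq

theorem hasDerivAt_inner_line_left (x v ξ : EuclideanSpace ℝ (Fin 2)) :
    HasDerivAt (fun t : ℝ => (inner ℝ (x + t • v) ξ : ℝ)) (inner ℝ v ξ) 0 := by
  simpa using (hasDerivAt_line x v).inner ℝ (hasDerivAt_const 0 ξ)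

theorem hasDerivAt_inner_line_right (x v ξ : EuclideanSpace ℝ (Fin 2)) :
    HasDerivAt (fun t : ℝ => (inner ℝ x (ξ + t • v) : ℝ)) (inner ℝ x v) 0 := by
  simpa using (hasDerivAt_const 0 x).inner ℝ (hasDerivAt_line ξ v)

theorem hasDerivAt_coord_line (x v : EuclideanSpace ℝ (Fin 2)) (k : Fin 2) :
    HasDerivAt (fun t : ℝ => (x + t • v) k) (v k) 0 := by
  simpa using ((hasDerivAt_id (0 : ℝ)).mul_const (v k)).const_add (x k)

theorem hasDerivAt_sqrt_kleinForm_base (h : 0 < kleinForm r x ξ) :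
    HasDerivAt (fun t : ℝ => √(kleinForm r (x + t • v) ξ))
      ((inner ℝ x ξ * inner ℝ v ξ - inner ℝ x v * ‖ξ‖ ^ 2) / √(kleinForm r x ξ)) 0 := by
  have h1 := ((((hasDerivAt_normSq_line x v).const_sub (r ^ 2)).mul_const (‖ξ‖ ^ 2)).add
    ((hasDerivAt_inner_line_left x v ξ).pow 2)).sqrt (by simpa [kleinForm] using h.ne')
  refine h1.congr_deriv ?_
  have := Real.sqrt_pos.2 h
  simp only [zero_smul, add_zero, Pi.add_apply, Pi.pow_apply, kleinForm] at this ⊢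
  field_simp
  push_cast
  ring

theorem hasDerivAt_sqrt_kleinForm_fibre (h : 0 < kleinForm r x ξ) :
    HasDerivAt (fun t : ℝ => √(kleinForm r x (ξ + t • v)))
      (((r ^ 2 - ‖x‖ ^ 2) * inner ℝ ξ v + inner ℝ x ξ * inner ℝ x v) / √(kleinForm r x ξ)) 0 := by
  have h1 := (((hasDerivAt_normSq_line ξ v).const_mul (r ^ 2 - ‖x‖ ^ 2)).add
    ((hasDerivAt_inner_line_right x v ξ).pow 2)).sqrt (by simpa [kleinForm] using h.ne')
  refine h1.congr_deriv ?_
  have := Real.sqrt_pos.2 h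
  simp only [zero_smul, add_zero, Pi.add_apply, Pi.pow_apply, kleinForm] at this ⊢
  field_simp
  push_cast
  ring

theorem hasDerivAt_sub_normSq_line (x v : EuclideanSpace ℝ (Fin 2)) (r : ℝ) :
    HasDerivAt (fun t : ℝ => r ^ 2 - ‖x + t • v‖ ^ 2) (-(2 * inner ℝ x v)) 0 :=
  (hasDerivAt_normSq_line x v).const_sub _

theorem hasDerivAt_one_add_mul_normSq_line (x v : EuclideanSpace ℝ (Fin 2)) (ε : ℝ) :
    HasDerivAt (fun t : ℝ => 1 + ε * ‖x + t • v‖ ^ 2) (ε * (2 * inner ℝ x v)) 0 :=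
  ((hasDerivAt_normSq_line x v).const_mul ε).const_add 1

theorem hasLineDerivAt_alpha_fibre (hx : 0 < r ^ 2 - ‖x‖ ^ 2) (hξ : ξ ≠ 0) :
    HasLineDerivAt ℝ (fun η => alpha r x η)
      (((r ^ 2 - ‖x‖ ^ 2) * inner ℝ ξ v + inner ℝ x ξ * inner ℝ x v)
        / (√(kleinForm r x ξ) * (r ^ 2 - ‖x‖ ^ 2))) ξ v := by
  have h1 := (hasDerivAt_sqrt_kleinForm_fibre (v := v) (kleinForm_pos hx hξ)).div_const
    (r ^ 2 - ‖x‖ ^ 2)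
  exact h1.congr_deriv (div_div _ _ _)

theorem hasLineDerivAt_funk_fibre (hx : 0 < r ^ 2 - ‖x‖ ^ 2) (hξ : ξ ≠ 0) :
    HasLineDerivAt ℝ (fun η => funk ε r x η)
      (((r ^ 2 - ‖x‖ ^ 2) * inner ℝ ξ v + inner ℝ x ξ * inner ℝ x v)
        / (√(kleinForm r x ξ) * (r ^ 2 - ‖x‖ ^ 2))
      + (1 + ε * r ^ 2) * inner ℝ x v / ((r ^ 2 - ‖x‖ ^ 2) * (1 + ε * ‖x‖ ^ 2))) ξ v :=
  (hasLineDerivAt_alpha_fibre (v := v) hx hξ).add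
    (((hasDerivAt_inner_line_right x v ξ).const_mul (1 + ε * r ^ 2)).div_const
      ((r ^ 2 - ‖x‖ ^ 2) * (1 + ε * ‖x‖ ^ 2)))

theorem hasLineDerivAt_funk_base (hx : 0 < r ^ 2 - ‖x‖ ^ 2) (hE : 0 < 1 + ε * ‖x‖ ^ 2)
    (hξ : ξ ≠ 0) :
    HasLineDerivAt ℝ (fun y => funk ε r y ξ)
      ((inner ℝ x ξ * inner ℝ v ξ - inner ℝ x v * ‖ξ‖ ^ 2)
          / (√(kleinForm r x ξ) * (r ^ 2 - ‖x‖ ^ 2))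
        + 2 * inner ℝ x v * √(kleinForm r x ξ) / (r ^ 2 - ‖x‖ ^ 2) ^ 2
        + (1 + ε * r ^ 2) * (inner ℝ v ξ / ((r ^ 2 - ‖x‖ ^ 2) * (1 + ε * ‖x‖ ^ 2))
          + 2 * inner ℝ x v * inner ℝ x ξ / ((r ^ 2 - ‖x‖ ^ 2) ^ 2 * (1 + ε * ‖x‖ ^ 2))
          - 2 * ε * inner ℝ x v * inner ℝ x ξ
            / ((r ^ 2 - ‖x‖ ^ 2) * (1 + ε * ‖x‖ ^ 2) ^ 2))) x v := by
  have hA := kleinForm_pos hx hξ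
  have h1 := ((hasDerivAt_sqrt_kleinForm_base (v := v) hA).div (hasDerivAt_sub_normSq_line x v r)
    (by simpa using hx.ne')).add
    (((hasDerivAt_inner_line_left x v ξ).const_mul (1 + ε * r ^ 2)).div
      ((hasDerivAt_sub_normSq_line x v r).mul (hasDerivAt_one_add_mul_normSq_line x v ε))
      (by simpa using ⟨hx.ne', hE.ne'⟩))
  refine h1.congr_deriv ?_
  have hA' := Real.sqrt_pos.2 hA
  simp only [zero_smul, add_zero, Pi.mul_apply]
  generalize √(kleinForm r x ξ) = A at *
  generalize hDD : r ^ 2 - ‖x‖ ^ 2 = D at *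
  generalize hEE : 1 + ε * ‖x‖ ^ 2 = E at *
  field_simp
  ring

theorem inner_single_right (x : EuclideanSpace ℝ (Fin 2)) (k : Fin 2) :
    inner ℝ x (EuclideanSpace.single k 1) = x k := by
  simp [EuclideanSpace.inner_single_right]

theorem inner_single_left (x : EuclideanSpace ℝ (Fin 2)) (k : Fin 2) :
    inner ℝ (EuclideanSpace.single k 1) x = x k := by
  simp [EuclideanSpace.inner_single_left]

theorem pdFibre_alpha (hx : 0 < r ^ 2 - ‖x‖ ^ 2) (hξ : ξ ≠ 0) (k : Fin 2) :
    pdFibre k (alpha r) x ξ = ((r ^ 2 - ‖x‖ ^ 2) * ξ k + inner ℝ x ξ * x k)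
        / (√(kleinForm r x ξ) * (r ^ 2 - ‖x‖ ^ 2)) := by
  have h := (hasLineDerivAt_alpha_fibre (v := EuclideanSpace.single k 1) hx hξ).lineDeriv
  rwa [inner_single_right, inner_single_right] at h

theorem pdFibre_funk (hx : 0 < r ^ 2 - ‖x‖ ^ 2) (hξ : ξ ≠ 0) (k : Fin 2) :
    pdFibre k (funk ε r) x ξ = ((r ^ 2 - ‖x‖ ^ 2) * ξ k + inner ℝ x ξ * x k)
        / (√(kleinForm r x ξ) * (r ^ 2 - ‖x‖ ^ 2))
      + (1 + ε * r ^ 2) * x k / ((r ^ 2 - ‖x‖ ^ 2) * (1 + ε * ‖x‖ ^ 2)) := by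
  have h := (hasLineDerivAt_funk_fibre (ε := ε) (v := EuclideanSpace.single k 1) hx hξ).lineDeriv
  rwa [inner_single_right, inner_single_right] at h

/-- `1 + ε|x|²` is positive on the disc. -/
theorem one_add_mul_normSq_pos (hε : ε = -1 ∨ ε = 0 ∨ ε = 1) (hr : 0 < r) (hr1 : ε ≠ 0 → r ≤ 1)
    (hx : 0 < r ^ 2 - ‖x‖ ^ 2) : 0 < 1 + ε * ‖x‖ ^ 2 := by
  rcases hε with rfl | rfl | rfl
  · have := hr1 (by norm_num)
    nlinarith
  · norm_num
  · positivity

theorem sub_normSq_pos (hx : x ∈ Metric.ball (0 : EuclideanSpace ℝ (Fin 2)) r) :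
    0 < r ^ 2 - ‖x‖ ^ 2 := by
  have h := mem_ball_zero_iff.1 hx
  nlinarith [norm_nonneg x]

/-- `|β| < α` off the zero section. -/
theorem funk_pos (hε : ε = -1 ∨ ε = 0 ∨ ε = 1) (hr : 0 < r) (hr1 : ε ≠ 0 → r ≤ 1)
    (hx : 0 < r ^ 2 - ‖x‖ ^ 2) (hξ : ξ ≠ 0) : 0 < funk ε r x ξ := by
  have hE := one_add_mul_normSq_pos hε hr hr1 hx
  have hq : 0 < ‖ξ‖ ^ 2 := pow_pos (norm_pos_iff.2 hξ) 2
  have hb : inner ℝ x ξ ^ 2 ≤ ‖x‖ ^ 2 * ‖ξ‖ ^ 2 := by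
    rw [← mul_pow]
    exact sq_le_sq' (neg_le_of_abs_le (abs_real_inner_le_norm x ξ)) (real_inner_le_norm x ξ)
  have key : ((1 + ε * r ^ 2) * inner ℝ x ξ / (1 + ε * ‖x‖ ^ 2)) ^ 2 < kleinForm r x ξ := by
    rw [div_pow, div_lt_iff₀ (pow_pos hE 2), kleinForm]
    generalize (inner ℝ x ξ : ℝ) = b at *
    have hs0 : 0 ≤ ‖x‖ ^ 2 := by positivity
    generalize ‖ξ‖ ^ 2 = q at *
    generalize ‖x‖ ^ 2 = s at *
    have hmul : 0 < (r ^ 2 - s) * q * (1 + ε * s) ^ 2 := by positivity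
    rcases hε with rfl | rfl | rfl
    · have := hr1 (by norm_num)
      have h1 : (1 + -1 * r ^ 2) ^ 2 ≤ (1 + -1 * s) ^ 2 := by
        apply pow_le_pow_left₀ <;> nlinarith
      nlinarith [mul_le_mul_of_nonneg_right h1 (sq_nonneg b)]
    · nlinarith
    · have hr2 : r ^ 2 ≤ 1 := pow_le_one₀ hr.le (hr1 (by norm_num))
      have hrs : 0 < 1 - r ^ 2 * s := by nlinarith
      -- by Cauchy–Schwarz the worst case is `⟨x, ξ⟩² = |x|²|ξ|²`
      have h1 : 0 ≤ ((1 + r ^ 2) ^ 2 - (1 + s) ^ 2) * (s * q - b ^ 2) :=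
        mul_nonneg (by nlinarith) (by linarith)
      have h2 : 0 < q * ((r ^ 2 - s) * (1 - r ^ 2 * s)) := by positivity
      nlinarith
  have h2 := (Real.lt_sqrt (abs_nonneg _)).2 ((sq_abs _).trans_lt key)
  have h3 := (abs_lt.1 h2).1
  have h4 : funk ε r x ξ = (√(kleinForm r x ξ)
      + (1 + ε * r ^ 2) * inner ℝ x ξ / (1 + ε * ‖x‖ ^ 2)) / (r ^ 2 - ‖x‖ ^ 2) := by
    rw [funk, alpha_eq, beta]
    field_simp
  rw [h4]
  exact div_pos (by linarith) hx

theorem smoothOffZero_funk (hε : ε = -1 ∨ ε = 0 ∨ ε = 1) (hr : 0 < r) (hr1 : ε ≠ 0 → r ≤ 1) :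
    SmoothOffZero (Metric.ball 0 r) (funk ε r) := by
  intro p hp
  have hx := sub_normSq_pos hp.1
  have hE := one_add_mul_normSq_pos hε hr hr1 hx
  have hA := kleinForm_pos hx hp.2
  have n1 : ContDiffAt ℝ ∞ (fun p : EuclideanSpace ℝ (Fin 2) × EuclideanSpace ℝ (Fin 2) =>
    ‖p.1‖ ^ 2) p := contDiffAt_fst.norm_sq ℝ
  have n2 : ContDiffAt ℝ ∞ (fun p : EuclideanSpace ℝ (Fin 2) × EuclideanSpace ℝ (Fin 2) =>
    ‖p.2‖ ^ 2) p := contDiffAt_snd.norm_sq ℝ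
  have n3 : ContDiffAt ℝ ∞ (fun p : EuclideanSpace ℝ (Fin 2) × EuclideanSpace ℝ (Fin 2) =>
    (inner ℝ p.1 p.2 : ℝ)) p := contDiffAt_fst.inner ℝ contDiffAt_snd
  have d1 := contDiffAt_const (c := r ^ 2) |>.sub n1
  have e1 := contDiffAt_const (c := (1 : ℝ)) |>.add (contDiffAt_const (c := ε) |>.mul n1)
  refine ContDiffAt.contDiffWithinAt ?_
  exact ((((d1.mul n2).add (n3.pow 2)).sqrt hA.ne').div d1 hx.ne').add
    ((contDiffAt_const (c := 1 + ε * r ^ 2) |>.mul n3).div (d1.mul e1) (mul_pos hx hE).ne')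

end Funk

/-! ### The curvature of the Funk–Finsler metric -/

section Funk

variable {ε r : ℝ} {x ξ v : EuclideanSpace ℝ (Fin 2)}

theorem normSq_eq_coord (x : EuclideanSpace ℝ (Fin 2)) : ‖x‖ ^ 2 = x 0 ^ 2 + x 1 ^ 2 := by
  rw [EuclideanSpace.real_norm_sq_eq, Fin.sum_univ_two]

theorem inner_eq_coord (x y : EuclideanSpace ℝ (Fin 2)) :
    (inner ℝ x y : ℝ) = x 0 * y 0 + x 1 * y 1 := by
  rw [PiLp.inner_apply, Fin.sum_univ_two]
  simp [mul_comm]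

theorem sq_sqrt_kleinForm (hx : 0 < r ^ 2 - ‖x‖ ^ 2) (hξ : ξ ≠ 0) :
    √(kleinForm r x ξ) ^ 2 = (r ^ 2 - ‖x‖ ^ 2) * ‖ξ‖ ^ 2 + inner ℝ x ξ ^ 2 :=
  Real.sq_sqrt (kleinForm_pos hx hξ).le

theorem pdFibre_pdFibre_funk (hx : 0 < r ^ 2 - ‖x‖ ^ 2) (hξ : ξ ≠ 0) (i k : Fin 2) :
    pdFibre i (pdFibre k (funk ε r)) x ξ =
      ((r ^ 2 - ‖x‖ ^ 2) * (if k = i then 1 else 0) + x i * x k)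
        / (√(kleinForm r x ξ) * (r ^ 2 - ‖x‖ ^ 2))
      - ((r ^ 2 - ‖x‖ ^ 2) * ξ i + inner ℝ x ξ * x i)
          * ((r ^ 2 - ‖x‖ ^ 2) * ξ k + inner ℝ x ξ * x k)
        / (√(kleinForm r x ξ) ^ 3 * (r ^ 2 - ‖x‖ ^ 2)) := by
  have hA := kleinForm_pos hx hξ
  have hA' := Real.sqrt_pos.2 hA
  have h1 := ((((hasDerivAt_coord_line ξ (EuclideanSpace.single i 1) k).const_mul
      (r ^ 2 - ‖x‖ ^ 2)).add
    ((hasDerivAt_inner_line_right x (EuclideanSpace.single i 1) ξ).mul_const (x k))).div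
    ((hasDerivAt_sqrt_kleinForm_fibre (v := EuclideanSpace.single i 1) hA).mul_const
      (r ^ 2 - ‖x‖ ^ 2)) (by simpa using ⟨hA'.ne', hx.ne'⟩)).add_const
    ((1 + ε * r ^ 2) * x k / ((r ^ 2 - ‖x‖ ^ 2) * (1 + ε * ‖x‖ ^ 2)))
  rw [pdFibre, Filter.EventuallyEq.lineDeriv_eq (by
    filter_upwards [isOpen_ne.mem_nhds hξ] with η hη using pdFibre_funk (ε := ε) hx hη k)]
  refine Eq.trans h1.deriv ?_
  rw [inner_single_right, inner_single_right]
  simp only [zero_smul, add_zero, PiLp.single_apply, Pi.add_apply]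
  generalize √(kleinForm r x ξ) = A at *
  generalize hDD : r ^ 2 - ‖x‖ ^ 2 = D at *
  split_ifs <;> field_simp

theorem sum_mul_pdFibre_funk (hx : 0 < r ^ 2 - ‖x‖ ^ 2) (hξ : ξ ≠ 0) :
    ξ 0 * pdFibre 0 (funk ε r) x ξ + ξ 1 * pdFibre 1 (funk ε r) x ξ = funk ε r x ξ := by
  have hA := Real.sqrt_pos.2 (kleinForm_pos hx hξ)
  have hA2 := sq_sqrt_kleinForm hx hξ
  rw [pdFibre_funk hx hξ, pdFibre_funk hx hξ, funk, alpha_eq, beta]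
  have e : ∀ a : ℝ, a / (r ^ 2 - ‖x‖ ^ 2) =
      a ^ 2 / (a * (r ^ 2 - ‖x‖ ^ 2)) := fun a => by
    by_cases h : a = 0
    · simp [h]
    · field_simp
  rw [e √(kleinForm r x ξ), hA2, normSq_eq_coord ξ, inner_eq_coord x ξ]
  ring

/-- In dimension two `g_ξ(v, v) = F r² (v × ξ)² / A³ + (F_{ξⁱ} vⁱ)²`, where `A = (r² - |x|²) α`;
the coefficient `r²` is the determinant of the form `A²` divided by `r² - |x|²`. -/
theorem quadratic_fundamentalTensor_funk
    (hs : SmoothOffZero (Metric.ball 0 r) (funk ε r))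
    (hxb : x ∈ Metric.ball (0 : EuclideanSpace ℝ (Fin 2)) r) (hξ : ξ ≠ 0) (v : Fin 2 → ℝ) :
    ∑ i, v i * ∑ j, fundamentalTensor (funk ε r) x ξ i j * v j =
      funk ε r x ξ * r ^ 2 * (v 0 * ξ 1 - v 1 * ξ 0) ^ 2 / √(kleinForm r x ξ) ^ 3
        + (pdFibre 0 (funk ε r) x ξ * v 0 + pdFibre 1 (funk ε r) x ξ * v 1) ^ 2 := by
  have hx := sub_normSq_pos hxb
  have hA := Real.sqrt_pos.2 (kleinForm_pos hx hξ)
  have hA2 := sq_sqrt_kleinForm hx hξ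
  simp only [Fin.sum_univ_two, fundamentalTensor_eq hs Metric.isOpen_ball hxb hξ,
    pdFibre_pdFibre_funk hx hξ]
  generalize pdFibre 0 (funk ε r) x ξ = F0
  generalize pdFibre 1 (funk ε r) x ξ = F1
  generalize funk ε r x ξ = F
  generalize √(kleinForm r x ξ) = A at *
  have hr : r ^ 2 = (r ^ 2 - ‖x‖ ^ 2) + (x 0 ^ 2 + x 1 ^ 2) := by
    rw [← normSq_eq_coord]; ring
  rw [normSq_eq_coord ξ] at hA2
  rw [inner_eq_coord x ξ] at hA2 ⊢
  generalize hDD : r ^ 2 - ‖x‖ ^ 2 = D at *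
  rw [hr]
  have h01 : (1 : Fin 2) ≠ 0 := by decide
  simp only [if_true, if_neg h01, if_neg h01.symm]
  field_simp
  rw [hA2]
  ring

theorem posDef_fundamentalTensor_funk
    (hs : SmoothOffZero (Metric.ball 0 r) (funk ε r))
    (hF : 0 < funk ε r x ξ)
    (hxb : x ∈ Metric.ball (0 : EuclideanSpace ℝ (Fin 2)) r) (hξ : ξ ≠ 0) :
    (fundamentalTensor (funk ε r) x ξ).PosDef := by
  have hx := sub_normSq_pos hxb
  have hA := Real.sqrt_pos.2 (kleinForm_pos hx hξ)
  have hr : 0 < r ^ 2 := by nlinarith [sq_nonneg ‖x‖]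
  refine Matrix.PosDef.of_dotProduct_mulVec_pos ?_ fun v hv => ?_
  · ext i j
    rw [Matrix.conjTranspose_apply, star_trivial,
      fundamentalTensor_eq hs Metric.isOpen_ball hxb hξ,
      fundamentalTensor_eq hs Metric.isOpen_ball hxb hξ,
      pdFibre_pdFibre_comm Metric.isOpen_ball hs hxb hξ]
    ring
  · have h := quadratic_fundamentalTensor_funk hs hxb hξ v
    have e : star v ⬝ᵥ (fundamentalTensor (funk ε r) x ξ).mulVec v =
        ∑ i, v i * ∑ j, fundamentalTensor (funk ε r) x ξ i j * v j := by
      simp [dotProduct, Matrix.mulVec]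
    rw [e, h]
    have hE := sum_mul_pdFibre_funk (ε := ε) hx hξ
    generalize pdFibre 0 (funk ε r) x ξ = F0 at *
    generalize pdFibre 1 (funk ε r) x ξ = F1 at *
    have hq : 0 < ξ 0 ^ 2 + ξ 1 ^ 2 := by
      rw [← normSq_eq_coord]; exact pow_pos (norm_pos_iff.2 hξ) 2
    by_cases hc : v 0 * ξ 1 - v 1 * ξ 0 = 0
    · -- `v` is a multiple of `ξ`, and `F_{ξⁱ} ξⁱ = F ≠ 0`
      have hL : F0 * v 0 + F1 * v 1 ≠ 0 := by
        intro hL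
        have h1 : (v 0 * ξ 0 + v 1 * ξ 1) * funk ε r x ξ = 0 := by
          rw [← hE]
          linear_combination (ξ 0 ^ 2 + ξ 1 ^ 2) * hL + (F1 * ξ 0 - F0 * ξ 1) * hc
        have h2 := (mul_eq_zero.1 h1).resolve_right hF.ne'
        have h3 : (v 0 ^ 2 + v 1 ^ 2) * (ξ 0 ^ 2 + ξ 1 ^ 2) = 0 := by
          linear_combination (v 0 * ξ 0 + v 1 * ξ 1) * h2 + (v 0 * ξ 1 - v 1 * ξ 0) * hc
        have h4 := (mul_eq_zero.1 h3).resolve_right hq.ne'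
        refine hv (funext (Fin.forall_fin_two.2 ⟨?_, ?_⟩))
        · exact pow_eq_zero_iff (two_ne_zero) |>.1
            (le_antisymm (by nlinarith [sq_nonneg (v 1)]) (sq_nonneg (v 0)))
        · exact pow_eq_zero_iff (two_ne_zero) |>.1
            (le_antisymm (by nlinarith [sq_nonneg (v 0)]) (sq_nonneg (v 1)))
      have := sq_pos_of_ne_zero hL
      positivity
    · have := sq_pos_of_ne_zero hc
      positivity

theorem isFinslerOn_funk (hε : ε = -1 ∨ ε = 0 ∨ ε = 1) (hr : 0 < r) (hr1 : ε ≠ 0 → r ≤ 1) :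
    IsFinslerOn (Metric.ball 0 r) (funk ε r) where
  nonneg x hx ξ := by
    by_cases hξ : ξ = 0
    · simp [hξ, funk, alpha, beta]
    · exact (funk_pos hε hr hr1 (sub_normSq_pos hx) hξ).le
  smooth := smoothOffZero_funk hε hr hr1
  homogeneous x _ ξ c hc := by
    have h : kleinForm r x (c • ξ) = c ^ 2 * kleinForm r x ξ := by
      simp only [kleinForm, norm_smul, inner_smul_right, mul_pow, Real.norm_eq_abs, sq_abs]
      ring
    rw [funk, funk, alpha_eq, alpha_eq, h, Real.sqrt_mul (sq_nonneg c), Real.sqrt_sq hc.le, beta,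
      beta, inner_smul_right]
    ring
  posDef x hx ξ hξ := posDef_fundamentalTensor_funk (smoothOffZero_funk hε hr hr1)
    (funk_pos hε hr hr1 (sub_normSq_pos hx) hξ) hx hξ

/-- The projective factor of the Funk–Finsler metric: that of `α` plus `φ / (2F)`. -/
noncomputable def funkFactor (ε r : ℝ) (x ξ : EuclideanSpace ℝ (Fin 2)) : ℝ :=
  inner ℝ x ξ / (r ^ 2 - ‖x‖ ^ 2) + phi ε r x ξ / (2 * funk ε r x ξ)

/-- The derivative of `F` along the line `x + tξ` is `2 F P`. -/
theorem hasLineDerivAt_funk_geodesic (hx : 0 < r ^ 2 - ‖x‖ ^ 2) (hE : 0 < 1 + ε * ‖x‖ ^ 2)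
    (hF : 0 < funk ε r x ξ) (hξ : ξ ≠ 0) :
    HasLineDerivAt ℝ (fun y => funk ε r y ξ) (2 * (funk ε r x ξ * funkFactor ε r x ξ)) x ξ := by
  have h := hasLineDerivAt_funk_base (v := ξ) hx hE hξ
  have e : 2 * (funk ε r x ξ * funkFactor ε r x ξ) =
      2 * funk ε r x ξ * inner ℝ x ξ / (r ^ 2 - ‖x‖ ^ 2) + phi ε r x ξ := by
    rw [funkFactor]
    field_simp
  rw [e]
  convert h using 1
  rw [funk, alpha_eq, beta, phi, real_inner_self_eq_norm_sq]
  have hA := Real.sqrt_pos.2 (kleinForm_pos hx hξ)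
  generalize √(kleinForm r x ξ) = A at *
  generalize hDD : r ^ 2 - ‖x‖ ^ 2 = D at *
  generalize hEE : 1 + ε * ‖x‖ ^ 2 = E at *
  field_simp
  ring

theorem isProjectiveFactor_funk (hε : ε = -1 ∨ ε = 0 ∨ ε = 1) (hr : 0 < r)
    (hr1 : ε ≠ 0 → r ≤ 1) :
    IsProjectiveFactor (Metric.ball 0 r) (funk ε r) (funkFactor ε r) where
  geodesic x hxb ξ hξ := by
    have hx := sub_normSq_pos hxb
    rw [sum_mul_pdBase Metric.isOpen_ball (smoothOffZero_funk hε hr hr1) hxb hξ]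
    exact (hasLineDerivAt_funk_geodesic hx (one_add_mul_normSq_pos hε hr hr1 hx)
      (funk_pos hε hr hr1 hx hξ) hξ).lineDeriv
  hamel x hxb ξ hξ k := by
    have hx := sub_normSq_pos hxb
    have hE := one_add_mul_normSq_pos hε hr hr1 hx
    have hA := kleinForm_pos hx hξ
    have hA' := Real.sqrt_pos.2 hA
    have hA2 := sq_sqrt_kleinForm hx hξ
    rw [sum_mul_pdBase Metric.isOpen_ball
      ((smoothOffZero_funk hε hr hr1).pdFibre Metric.isOpen_ball k) hxb hξ]
    have h1 := ((((hasDerivAt_sub_normSq_line x ξ r).mul_const (ξ k)).add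
        ((hasDerivAt_inner_line_left x ξ ξ).mul (hasDerivAt_coord_line x ξ k))).div
      ((hasDerivAt_sqrt_kleinForm_base (v := ξ) hA).mul (hasDerivAt_sub_normSq_line x ξ r))
      (by simpa using ⟨hA'.ne', hx.ne'⟩)).add
      (((hasDerivAt_coord_line x ξ k).const_mul (1 + ε * r ^ 2)).div
      ((hasDerivAt_sub_normSq_line x ξ r).mul (hasDerivAt_one_add_mul_normSq_line x ξ ε))
      (by simpa using ⟨hx.ne', hE.ne'⟩))
    rw [Filter.EventuallyEq.lineDeriv_eq (by
      filter_upwards [Metric.isOpen_ball.mem_nhds hxb] with y hy using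
        pdFibre_funk (ε := ε) (sub_normSq_pos hy) hξ k)]
    refine Eq.trans h1.deriv ?_
    have h2 := (hasLineDerivAt_funk_base (v := EuclideanSpace.single k 1) hx hE hξ).lineDeriv
    rw [inner_single_left, inner_single_right] at h2
    rw [pdBase, h2, real_inner_self_eq_norm_sq]
    simp only [zero_smul, add_zero, Pi.mul_apply, Pi.add_apply]
    generalize √(kleinForm r x ξ) = A at *
    generalize hDD : r ^ 2 - ‖x‖ ^ 2 = D at *
    generalize hEE : 1 + ε * ‖x‖ ^ 2 = E at *
    generalize (inner ℝ x ξ : ℝ) = b at *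
    generalize ‖ξ‖ ^ 2 = q at *
    -- eliminating `|ξ|²` by `A² = D q + b²` leaves an identity of rational functions
    obtain rfl : q = (A ^ 2 - b ^ 2) / D := by field_simp; linarith
    field_simp
    ring

theorem hasLineDerivAt_phi_geodesic (hx : 0 < r ^ 2 - ‖x‖ ^ 2) (hE : 0 < 1 + ε * ‖x‖ ^ 2) :
    HasLineDerivAt ℝ (fun y => phi ε r y ξ)
      (psi ε r x ξ + 4 * inner ℝ x ξ / (r ^ 2 - ‖x‖ ^ 2) * phi ε r x ξ) x ξ := by
  have h1 := ((((hasDerivAt_one_add_mul_normSq_line x ξ ε).mul_const (‖ξ‖ ^ 2)).sub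
      (((hasDerivAt_inner_line_left x ξ ξ).pow 2).const_mul (2 * ε))).const_mul
      (1 + ε * r ^ 2)).div
    ((hasDerivAt_sub_normSq_line x ξ r).mul ((hasDerivAt_one_add_mul_normSq_line x ξ ε).pow 2))
    (by simpa using ⟨hx.ne', hE.ne'⟩)
  refine HasDerivAt.congr_deriv h1 ?_
  rw [phi, psi, real_inner_self_eq_norm_sq]
  simp only [zero_smul, add_zero, Pi.mul_apply, Pi.sub_apply, Pi.pow_apply]
  have e1 : 3 * ε * r ^ 2 - 2 * ε * ‖x‖ ^ 2 + 1 =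
      (1 + ε * ‖x‖ ^ 2) + 3 * ε * (r ^ 2 - ‖x‖ ^ 2) := by ring
  have e2 : 1 - ε * ‖x‖ ^ 2 + 2 * ε * r ^ 2 =
      (1 + ε * ‖x‖ ^ 2) + 2 * ε * (r ^ 2 - ‖x‖ ^ 2) := by ring
  rw [e1, e2]
  generalize hDD : r ^ 2 - ‖x‖ ^ 2 = D at *
  generalize hEE : 1 + ε * ‖x‖ ^ 2 = E at *
  field_simp
  push_cast
  ring

theorem flatCurvature_funkFactor (hε : ε = -1 ∨ ε = 0 ∨ ε = 1) (hr : 0 < r)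
    (hr1 : ε ≠ 0 → r ≤ 1) (hxb : x ∈ Metric.ball (0 : EuclideanSpace ℝ (Fin 2)) r) (hξ : ξ ≠ 0) :
    flatCurvature (funkFactor ε r) x ξ =
      3 * (phi ε r x ξ / (2 * funk ε r x ξ)) ^ 2 - psi ε r x ξ / (2 * funk ε r x ξ)
        - alpha r x ξ ^ 2 := by
  have hx := sub_normSq_pos hxb
  have hE := one_add_mul_normSq_pos hε hr hr1 hx
  have hF := funk_pos hε hr hr1 hx hξ
  have hA2 := sq_sqrt_kleinForm hx hξ
  have h1 := ((hasDerivAt_inner_line_left x ξ ξ).div (hasDerivAt_sub_normSq_line x ξ r)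
    (by simpa using hx.ne')).add
    ((hasLineDerivAt_phi_geodesic (ξ := ξ) hx hE).div
      ((hasLineDerivAt_funk_geodesic hx hE hF hξ).const_mul 2) (by simpa using hF.ne'))
  have hs := (isProjectiveFactor_funk hε hr hr1).smooth (isFinslerOn_funk hε hr hr1)
    Metric.isOpen_ball
  have h2 : lineDeriv ℝ (fun y => funkFactor ε r y ξ) x ξ = _ := h1.deriv
  rw [flatCurvature, sum_mul_pdBase Metric.isOpen_ball hs hxb hξ, h2,
    funkFactor, alpha_eq, div_pow _ (r ^ 2 - ‖x‖ ^ 2), hA2, real_inner_self_eq_norm_sq]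
  simp only [zero_smul, add_zero]
  generalize funk ε r x ξ = F at *
  generalize phi ε r x ξ = p at *
  generalize psi ε r x ξ = s at *
  generalize hDD : r ^ 2 - ‖x‖ ^ 2 = D at *
  field_simp
  ring

/-- `F τ_k = α (α F_{ξᵏ} - F α_{ξᵏ})`: the terms `α²` and `τ_k ξⁱ` of the curvature formula
combine to `-α² (δⁱ_k - F⁻¹ F_{ξᵏ} ξⁱ)`. -/
theorem tau_eq (hx : 0 < r ^ 2 - ‖x‖ ^ 2) (hE : 0 < 1 + ε * ‖x‖ ^ 2)
    (hF : 0 < funk ε r x ξ) (hξ : ξ ≠ 0) (k : Fin 2) :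
    tau ε r k x ξ = alpha r x ξ ^ 2 * (pdFibre k (funk ε r) x ξ / funk ε r x ξ)
      - alpha r x ξ * pdFibre k (alpha r) x ξ := by
  have hA := Real.sqrt_pos.2 (kleinForm_pos hx hξ)
  have hA2 := sq_sqrt_kleinForm hx hξ
  have e : tau ε r k x ξ = ((1 + ε * r ^ 2) * (x k * ‖ξ‖ ^ 2 - ξ k * inner ℝ x ξ) /
    ((r ^ 2 - ‖x‖ ^ 2) ^ 2 * (1 + ε * ‖x‖ ^ 2))) / funk ε r x ξ := by
    rw [tau, div_div]; ring_nf
  have e2 : alpha r x ξ ^ 2 * (pdFibre k (funk ε r) x ξ / funk ε r x ξ)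
      - alpha r x ξ * pdFibre k (alpha r) x ξ = (alpha r x ξ ^ 2 * pdFibre k (funk ε r) x ξ
      - alpha r x ξ * pdFibre k (alpha r) x ξ * funk ε r x ξ) / funk ε r x ξ := by
    field_simp
  rw [e, e2]
  congr 1
  rw [pdFibre_funk hx hξ, pdFibre_alpha hx hξ, funk, beta, alpha_eq]
  generalize √(kleinForm r x ξ) = A at *
  generalize hDD : r ^ 2 - ‖x‖ ^ 2 = D at *
  generalize hEE : 1 + ε * ‖x‖ ^ 2 = E at *
  generalize (inner ℝ x ξ : ℝ) = b at *
  generalize ‖ξ‖ ^ 2 = q at *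
  -- eliminating `|ξ|²` by `A² = D q + b²` leaves an identity of rational functions
  obtain rfl : q = (A ^ 2 - b ^ 2) / D := by field_simp; linarith
  field_simp
  ring

end Funk

end FunkFinsler

theorem mainTheorem5 (ε r : ℝ) (hε : ε = -1 ∨ ε = 0 ∨ ε = 1)
    (hr : 0 < r) (hr1 : ε ≠ 0 → r ≤ 1) :
    FunkFinsler.IsFinslerOn (Metric.ball 0 r) (FunkFinsler.funk ε r) ∧
    ∀ x ∈ Metric.ball (0 : EuclideanSpace ℝ (Fin 2)) r,
    ∀ ξ : EuclideanSpace ℝ (Fin 2), ξ ≠ 0 →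
      (∀ i k : Fin 2,
        FunkFinsler.riemannCurvature (FunkFinsler.funk ε r) i k x ξ =
          -((if i = k then 1 else 0) * FunkFinsler.alpha r x ξ ^ 2
              - FunkFinsler.alpha r x ξ
                * FunkFinsler.pdFibre k (FunkFinsler.alpha r) x ξ * ξ i)
          + (3 * (FunkFinsler.phi ε r x ξ / (2 * FunkFinsler.funk ε r x ξ)) ^ 2
              - FunkFinsler.psi ε r x ξ / (2 * FunkFinsler.funk ε r x ξ))
            * ((if i = k then 1 else 0)
              - FunkFinsler.pdFibre k (FunkFinsler.funk ε r) x ξ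
                / FunkFinsler.funk ε r x ξ * ξ i)
          + FunkFinsler.tau ε r k x ξ * ξ i) ∧
      FunkFinsler.ricciCurvature (FunkFinsler.funk ε r) x ξ =
        3 * (FunkFinsler.phi ε r x ξ / (2 * FunkFinsler.funk ε r x ξ)) ^ 2
          - FunkFinsler.psi ε r x ξ / (2 * FunkFinsler.funk ε r x ξ)
          - FunkFinsler.alpha r x ξ ^ 2 ∧
      ∀ u : EuclideanSpace ℝ (Fin 2), LinearIndependent ℝ ![ξ, u] →
        FunkFinsler.flagCurvature (FunkFinsler.funk ε r) x ξ u
            * FunkFinsler.funk ε r x ξ ^ 2 =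
          FunkFinsler.ricciCurvature (FunkFinsler.funk ε r) x ξ := by
  have hF := FunkFinsler.isFinslerOn_funk hε hr hr1
  have hP := FunkFinsler.isProjectiveFactor_funk hε hr hr1
  refine ⟨hF, fun x hxb ξ hξ => ?_⟩
  have hx := FunkFinsler.sub_normSq_pos hxb
  have hK := FunkFinsler.flatCurvature_funkFactor hε hr hr1 hxb hξ
  have hRic : FunkFinsler.ricciCurvature (FunkFinsler.funk ε r) x ξ =
      FunkFinsler.flatCurvature (FunkFinsler.funkFactor ε r) x ξ := by
    rw [hP.ricciCurvature_eq hF Metric.isOpen_ball hxb hξ]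
    norm_num
  refine ⟨fun i k => ?_, hRic.trans hK, fun u hu => ?_⟩
  · rw [hP.riemannCurvature_eq hF Metric.isOpen_ball hxb hξ, hK,
      FunkFinsler.tau_eq hx (FunkFinsler.one_add_mul_normSq_pos hε hr hr1 hx)
        (FunkFinsler.funk_pos hε hr hr1 hx hξ) hξ]
    ring
  · rw [hRic, hP.flagCurvature_mul_sq hF Metric.isOpen_ball hxb hξ hu]
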